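/- Let $k\ge 1$ and let $\alpha_1,\dots,\alpha_k>0$ with $\sum_{j=1}^k\alpha_j=1$. Let $S_k$ be the infinite star graph with $k$ edges, each identified with $\mathbb R^+=[0,\infty)$ and glued at the centre $0$, and let $\mathsf m$ be the measure on $S_k$ that is Lebesgue measure on each edge. Identify $L^1(S_k)=L^1(S_k,\mathsf m)$ with $[L^1(\mathbb R^+)]^k$, writing $\psi=(\psi(\cdot,j))_{1\le j\le k}$, with norm $\|\psi\|=\sum_{j}\|\psi(\cdot,j)\|_{L^1(\mathbb R^+)}$. A linear operator $P$ in $L^1(S_k)$ is a Markov operator if $P\psi\ge 0$ whenever $\psi\ge 0$, and $\int_{S_k}P\psi\,d\mathsf m=\int_{S_k}\psi\,d\mathsf m$ for all $\psi$. Let $A_\alpha$ be the operator in $L^1(S_k)$ whose domain $D(A_\alpha)$ consists of all $\psi\in L^1(S_k)$ such that $\psi(\cdot,j)\in W^{2,1}(\mathbb R^+)$ for each $j$, that is, there are $\psi(0,j),\psi'(0,j)\in\mathbb R$ and $\psi''(\cdot,j)\in L^1(\mathbb R^+)$ with $$\psi(x,j)=\psi(0,j)+\psi'(0,j)\,x+\int_0^x(x-y)\,\psi''(y,j)\,dy,\qquad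 x\ge 0,$$ and such that $$\sum_{j=1}^k\psi'(0,j)=0,\qquad \alpha_i^{-1}\psi(0,i)=\alpha_j^{-1}\psi(0,j)\quad\text{for all } i,j;$$ for such $\psi$ put $A_\alpha\psi=\tfrac12\psi''=\tfrac12(\psi''(\cdot,j))_{1\le j\le k}$. Let $C_0(S_k)$ be the space of sequences $f=(f_j)_{1\le j\le k}$ of continuous functions on $[0,\infty)$ vanishing at infinity with $f_i(0)=f_j(0)$ for all $i,j$, with the supremum norm. Let $G_\alpha$ be the infinitesimal generator of the Feller semigroup of Walsh's spider process with parameter $\alpha$, which is given for $f\in C_0(S_k)$ and $t\ge 0$ by $$(\mathcal T_\alpha(t)f)_j=T_{\min}(t)(f_j-\overline f)+T_{\mathrm{ref}}(t)\overline f,\qquad \overline f=\sum_{i=1}^k\alpha_if_i ,$$ where $T_{\mathrm{ref}}(t)h(x)=\mathbb E\,h(|x+w(t)|)$ is the semigroup of the reflecting Brownian motion on $[0,\infty)$ and $T_{\min}(t)g(x)=\mathbb E\,g^{\circ}(x+w(t))$ is the semigroup of the Brownian motion killed at $0$; here $w$ is a standard Brownian motion starting at $0$, and $g^\circ$ is the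 odd extension to $\mathbb R$ of a function $g$ on $[0,\infty)$ with $g(0)=0$. Then $A_\alpha$ is the generator of a strongly continuous semigroup of Markov operators in $L^1(S_k)$. Moreover, for all $f\in D(G_\alpha)$ and $\psi\in D(A_\alpha)$, $$\int_{S_k} f\,A_\alpha\psi\,d\mathsf m=\int_{S_k}(G_\alpha f)\,\psi\,d\mathsf m .$$ -/

import Mathlib

open MeasureTheory ProbabilityTheory Filter Topology Set
open scoped NNReal ZeroAtInfty ENNReal

namespace WalshSpider

/-! ### Infinitesimal generators -/

section Generator

variable {E : Type*} [NormedAddCommGroup E] [NormedSpace ℝ E]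

/-- The graph of the infinitesimal generator of a family `(T t)`, `t ≥ 0`, of linear operators in
`E`: the set of pairs `(x, y)` with `(T t x - x) / t → y` in norm as `t → 0+`. -/
def generatorGraph (T : ℝ≥0 → E →ₗ[ℝ] E) : Submodule ℝ (E × E) where
  carrier := {p | Tendsto (fun t : ℝ≥0 => (t : ℝ)⁻¹ • (T t p.1 - p.1)) (𝓝[>] 0) (𝓝 p.2)}
  add_mem' := by
    intro p q hp hq
    have h := Tendsto.add hp hq
    refine h.congr fun t => ?_
    simp only [Prod.fst_add, map_add]
    module
  zero_mem' := by simp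
  smul_mem' := by
    intro c p hp
    have h := Tendsto.const_smul hp c
    refine h.congr fun t => ?_
    simp only [Prod.smul_fst, map_smul]
    module

theorem generatorGraph_fst_eq_zero (T : ℝ≥0 → E →ₗ[ℝ] E) :
    ∀ p ∈ generatorGraph T, p.1 = 0 → p.2 = 0 := by
  rintro ⟨x, y⟩ hp hx
  have hp' : Tendsto (fun t : ℝ≥0 => (t : ℝ)⁻¹ • (T t x - x)) (𝓝[>] 0) (𝓝 y) := hp
  obtain rfl : x = 0 := hx
  simp only [map_zero, sub_zero, smul_zero] at hp'
  exact (tendsto_nhds_unique hp' tendsto_const_nhds)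

/-- The infinitesimal generator: `x` is in the domain iff `lim_{t → 0+} (T t x - x) / t` exists,
and the limit is then the value at `x`. -/
noncomputable def generator (T : ℝ≥0 → E →ₗ[ℝ] E) : E →ₗ.[ℝ] E :=
  (generatorGraph T).toLinearPMap

theorem generator_graph (T : ℝ≥0 → E →ₗ[ℝ] E) : (generator T).graph = generatorGraph T :=
  Submodule.toLinearPMap_graph_eq _ (fun p hp h => generatorGraph_fst_eq_zero T p hp h)

end Generator

/-! ### The space `L¹(S_k)` and Markov operators in it -/

/-- Lebesgue measure on the half-line `[0, ∞)`. -/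
noncomputable abbrev halfLine : Measure ℝ := volume.restrict (Ici 0)

/-- `L¹(ℝ⁺)`. -/
abbrev L1Half : Type := Lp ℝ 1 halfLine

/-- `L¹(S_k)`: the `k`-fold product of `L¹(ℝ⁺)`, one factor for each edge of the star graph,
with norm `∑ j, ‖ψ j‖`. -/
abbrev L1Star (k : ℕ) : Type := PiLp 1 (fun _ : Fin k => L1Half)

/-- The integral over `S_k`, with respect to the measure that is Lebesgue measure on each edge, of
a function with values `h j x` at distance `x ≥ 0` from the centre on the edge `j`. -/
noncomputable def starIntegral {k : ℕ} (h : Fin k → ℝ → ℝ) : ℝ :=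
  ∑ j, ∫ x in Ici (0 : ℝ), h j x

/-- Markov operators: positive operators in `L¹(S_k)` which preserve the integral. -/
structure IsMarkovOperator {k : ℕ} (P : L1Star k →L[ℝ] L1Star k) : Prop where
  nonneg : ∀ ψ : L1Star k, (∀ j, 0 ≤ ψ j) → ∀ j, 0 ≤ P ψ j
  integral_eq : ∀ ψ : L1Star k, starIntegral (fun j x => P ψ j x) = starIntegral (fun j x => ψ j x)

/-- Strongly continuous semigroups of Markov operators in `L¹(S_k)`. -/
structure IsMarkovSemigroup {k : ℕ} (T : ℝ≥0 → L1Star k →L[ℝ] L1Star k) : Prop where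
  map_zero : T 0 = ContinuousLinearMap.id ℝ (L1Star k)
  map_add : ∀ s t, T (s + t) = (T s).comp (T t)
  continuous : ∀ ψ : L1Star k, Continuous fun t => T t ψ
  markov : ∀ t, IsMarkovOperator (T t)

/-! ### The operator `A_α` -/

/-- `u` belongs to `W^{2,1}(ℝ⁺)`, with `u(0) = a`, `u'(0) = b` and `u'' = v` in `L¹(ℝ⁺)`:
`u(x) = a + b x + ∫₀ˣ (x - y) v(y) dy` for (almost) all `x ≥ 0`. -/
def HasSecondDeriv (u v : L1Half) (a b : ℝ) : Prop :=
  ∀ᵐ x ∂halfLine, u x = a + b * x + ∫ y in (0 : ℝ)..x, (x - y) * v y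

theorem intervalIntegrable_kernel (v : L1Half) {x : ℝ} (hx : 0 ≤ x) :
    IntervalIntegrable (fun y => (x - y) * v y) volume 0 x := by
  have hv : IntegrableOn (v : ℝ → ℝ) (Ici 0) volume := L1.integrable_coeFn v
  have : IntervalIntegrable (v : ℝ → ℝ) volume 0 x :=
    (intervalIntegrable_iff_integrableOn_Icc_of_le hx).2 (hv.mono_set Icc_subset_Ici_self)
  exact this.continuousOn_mul (by fun_prop)

theorem integral_kernel_congr {v w : ℝ → ℝ} (h : v =ᵐ[halfLine] w) {x : ℝ} (hx : 0 ≤ x) :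
    ∫ y in (0 : ℝ)..x, (x - y) * v y = ∫ y in (0 : ℝ)..x, (x - y) * w y := by
  refine intervalIntegral.integral_congr_ae ?_
  have h' := (ae_restrict_iff' measurableSet_Ici).1 h
  filter_upwards [h'] with y hy hy'
  rw [uIoc_of_le hx] at hy'
  rw [hy hy'.1.le]

theorem HasSecondDeriv.add {u v u' v' : L1Half} {a b a' b' : ℝ}
    (h : HasSecondDeriv u v a b) (h' : HasSecondDeriv u' v' a' b') :
    HasSecondDeriv (u + u') (v + v') (a + a') (b + b') := by
  unfold HasSecondDeriv at *
  filter_upwards [h, h', Lp.coeFn_add u u', ae_restrict_mem measurableSet_Ici] with x h1 h2 h3 hx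
  have hx : 0 ≤ x := hx
  rw [h3, Pi.add_apply, h1, h2, integral_kernel_congr (Lp.coeFn_add v v') hx]
  simp only [Pi.add_apply, mul_add]
  rw [intervalIntegral.integral_add (intervalIntegrable_kernel v hx)
    (intervalIntegrable_kernel v' hx)]
  ring

theorem HasSecondDeriv.smul {u v : L1Half} {a b : ℝ} (c : ℝ) (h : HasSecondDeriv u v a b) :
    HasSecondDeriv (c • u) (c • v) (c * a) (c * b) := by
  unfold HasSecondDeriv at *
  filter_upwards [h, Lp.coeFn_smul c u, ae_restrict_mem measurableSet_Ici] with x h1 h3 hx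
  have hx : 0 ≤ x := hx
  rw [h3, Pi.smul_apply, h1, integral_kernel_congr (Lp.coeFn_smul c v) hx]
  simp only [Pi.smul_apply, smul_eq_mul]
  have : ∀ y, (x - y) * (c * v y) = c * ((x - y) * v y) := fun y => by ring
  simp only [this, intervalIntegral.integral_const_mul]
  ring

theorem hasSecondDeriv_zero : HasSecondDeriv 0 0 0 0 := by
  unfold HasSecondDeriv
  filter_upwards [Lp.coeFn_zero ℝ 1 halfLine, ae_restrict_mem measurableSet_Ici] with x h hx
  have hx : 0 ≤ x := hx
  rw [h, integral_kernel_congr (Lp.coeFn_zero ℝ 1 halfLine) hx]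
  simp

theorem HasSecondDeriv.eq_zero {u v : L1Half} {a b : ℝ} (h : HasSecondDeriv u v a b)
    (hu : u = 0) : v = 0 := by
  subst hu
  set w : ℝ → ℝ := (Ici 0).indicator v with hw
  have hvi : IntegrableOn (v : ℝ → ℝ) (Ici 0) volume := L1.integrable_coeFn v
  have hwi : Integrable w := hvi.integrable_indicator measurableSet_Ici
  have hyw : LocallyIntegrable (fun y => y * w y) :=
    hwi.locallyIntegrable.continuous_mul (g := fun y : ℝ => y) continuous_id
  have hyw' : ∀ p q : ℝ, IntervalIntegrable (fun y => y * w y) volume p q := fun p q =>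
    (hyw.integrableOn_isCompact isCompact_uIcc).intervalIntegrable
  set V : ℝ → ℝ := fun x => ∫ y in (0 : ℝ)..x, w y
  set W : ℝ → ℝ := fun x => ∫ y in (0 : ℝ)..x, y * w y
  have hV : Continuous V :=
    intervalIntegral.continuous_primitive (fun _ _ => hwi.intervalIntegrable) 0
  have hW : Continuous W :=
    intervalIntegral.continuous_primitive hyw' 0
  have hdV := LocallyIntegrable.ae_hasDerivAt_integral hwi.locallyIntegrable
  have hdW := LocallyIntegrable.ae_hasDerivAt_integral hyw
  -- the identity holds almost everywhere, hence everywhere, on `(0, ∞)`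
  have h1 : (fun x => a + b * x + (x * V x - W x)) =ᵐ[volume.restrict (Ioi (0 : ℝ))]
      fun _ => (0 : ℝ) := by
    have h0 := ae_restrict_of_ae_restrict_of_subset Ioi_subset_Ici_self h
    have hz := ae_restrict_of_ae_restrict_of_subset Ioi_subset_Ici_self
      (Lp.coeFn_zero ℝ 1 halfLine)
    filter_upwards [h0, hz, ae_restrict_mem measurableSet_Ioi] with x hx hx0 hpos
    have hpos : 0 < x := hpos
    rw [hx0] at hx
    have hvw : (v : ℝ → ℝ) =ᵐ[halfLine] w :=
      (indicator_ae_eq_restrict measurableSet_Ici).symm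
    rw [integral_kernel_congr hvw hpos.le] at hx
    have : ∫ y in (0 : ℝ)..x, (x - y) * w y = x * V x - W x := by
      simp only [sub_mul]
      rw [intervalIntegral.integral_sub (hwi.intervalIntegrable.const_mul x)
        (hyw' _ _), intervalIntegral.integral_const_mul]
    rw [this] at hx
    simpa using hx.symm
  have h2 : EqOn (fun x => a + b * x + (x * V x - W x)) (fun _ => (0 : ℝ)) (Ioi 0) :=
    Measure.eqOn_open_of_ae_eq h1 isOpen_Ioi (by fun_prop) (by fun_prop)
  have h3 : (fun x => b + V x) =ᵐ[volume.restrict (Ioi (0 : ℝ))] fun _ => (0 : ℝ) := by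
    filter_upwards [ae_restrict_of_ae hdV, ae_restrict_of_ae hdW,
      ae_restrict_mem measurableSet_Ioi] with x hx1 hx2 hpos
    have hd : HasDerivAt (fun x => a + b * x + (x * V x - W x))
        (b * 1 + ((1 * V x + x * w x) - x * w x)) x :=
      (((hasDerivAt_id x).const_mul b).const_add a).add
        (((hasDerivAt_id x).mul (hx1 0)).sub (hx2 0))
    have hd0 : HasDerivAt (fun x => a + b * x + (x * V x - W x)) 0 x :=
      (hasDerivAt_const x (0 : ℝ)).congr_of_eventuallyEq
        (h2.eventuallyEq_of_mem (Ioi_mem_nhds hpos))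
    have := hd.unique hd0
    linarith
  have h4 : EqOn (fun x => b + V x) (fun _ => (0 : ℝ)) (Ioi 0) :=
    Measure.eqOn_open_of_ae_eq h3 isOpen_Ioi (by fun_prop) (by fun_prop)
  refine Lp.ext ?_
  refine EventuallyEq.trans ?_ (Lp.coeFn_zero ℝ 1 halfLine).symm
  have h5 : ∀ᵐ x ∂(volume.restrict (Ioi (0 : ℝ))), v x = (0 : ℝ → ℝ) x := by
    filter_upwards [ae_restrict_of_ae hdV, ae_restrict_mem measurableSet_Ioi] with x hx1 hpos
    have hd0 : HasDerivAt (fun x => b + V x) 0 x :=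
      (hasDerivAt_const x (0 : ℝ)).congr_of_eventuallyEq
        (h4.eventuallyEq_of_mem (Ioi_mem_nhds hpos))
    have := ((hx1 0).const_add b).unique hd0
    rw [hw, indicator_of_mem (show x ∈ Ici (0 : ℝ) from Ioi_subset_Ici_self hpos)] at this
    simpa using this
  rwa [restrict_Ioi_eq_restrict_Ici] at h5

variable {k : ℕ}

/-- The graph of `A_α`: pairs `(ψ, ½ ψ'')`, where `ψ j ∈ W^{2,1}(ℝ⁺)` for each edge `j`, and
`∑ j, ψ'(0, j) = 0`, and `ψ(0, j) / α j` does not depend on `j`. -/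
def walshDualGraph (α : Fin k → ℝ) : Submodule ℝ (L1Star k × L1Star k) where
  carrier := {p | ∃ (φ : L1Star k) (a b : Fin k → ℝ),
    (∀ j, HasSecondDeriv (p.1 j) (φ j) (a j) (b j)) ∧
    ∑ j, b j = 0 ∧ (∀ i j, a i / α i = a j / α j) ∧ p.2 = (1 / 2 : ℝ) • φ}
  add_mem' := by
    rintro p q ⟨φ, a, b, h1, h2, h3, h4⟩ ⟨φ', a', b', h1', h2', h3', h4'⟩
    refine ⟨φ + φ', a + a', b + b', fun j => (h1 j).add (h1' j), ?_, fun i j => ?_, ?_⟩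
    · simp [Finset.sum_add_distrib, h2, h2']
    · simp only [Pi.add_apply, add_div, h3 i j, h3' i j]
    · rw [Prod.snd_add, h4, h4', smul_add]
  zero_mem' :=
    ⟨0, 0, 0, fun _ => hasSecondDeriv_zero, by simp, by simp, by simp⟩
  smul_mem' := by
    rintro c p ⟨φ, a, b, h1, h2, h3, h4⟩
    refine ⟨c • φ, fun j => c * a j, fun j => c * b j, fun j => (h1 j).smul c, ?_,
      fun i j => ?_, ?_⟩
    · rw [← Finset.mul_sum, h2, mul_zero]
    · simp only [mul_div_assoc, h3 i j]
    · rw [Prod.smul_snd, h4, smul_comm]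

theorem walshDualGraph_fst_eq_zero (α : Fin k → ℝ) :
    ∀ p ∈ walshDualGraph α, p.1 = 0 → p.2 = 0 := by
  rintro p ⟨φ, a, b, h1, -, -, h4⟩ hp
  have : φ = 0 := by
    ext1 j
    exact (h1 j).eq_zero (by rw [hp]; rfl)
  rw [h4, this, smul_zero]

/-- The operator `A_α ψ = ½ ψ''` in `L¹(S_k)`, with the domain described at `walshDualGraph`. -/
noncomputable def walshDualOperator (α : Fin k → ℝ) : L1Star k →ₗ.[ℝ] L1Star k :=
  (walshDualGraph α).toLinearPMap

theorem walshDualOperator_graph (α : Fin k → ℝ) :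
    (walshDualOperator α).graph = walshDualGraph α :=
  Submodule.toLinearPMap_graph_eq _ (fun p hp h => walshDualGraph_fst_eq_zero α p hp h)

/-! ### The Feller semigroup of Walsh's spider process and its generator `G_α` -/

/-- `C₀[0, ∞)`, with the supremum norm. -/
abbrev C0Half : Type := C₀(ℝ≥0, ℝ)

/-- `C₀(0, ∞)`: the functions in `C₀[0, ∞)` that vanish at `0`. -/
def C0Open : Submodule ℝ C0Half where
  carrier := {g | g 0 = 0}
  add_mem' := by
    intro f g (hf : f 0 = 0) (hg : g 0 = 0)
    simp [hf, hg]
  zero_mem' := by simp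
  smul_mem' := by
    intro c f (hf : f 0 = 0)
    simp [hf]

/-- `C₀(S_k)`: sequences `(f j)` of functions in `C₀[0, ∞)`, one for each edge, with a common
value at the centre `0`; the norm is the supremum norm. -/
def C0Star (k : ℕ) : Submodule ℝ (Fin k → C0Half) where
  carrier := {f | ∀ i j, f i 0 = f j 0}
  add_mem' := by
    intro f g hf hg i j
    simp [hf i j, hg i j]
  zero_mem' := by simp
  smul_mem' := by
    intro c f hf i j
    simp [hf i j]

theorem integrable_comp (g : C0Half) (μ : Measure ℝ) [IsFiniteMeasure μ] {s : ℝ → ℝ≥0}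
    (hs : Continuous s) : Integrable (fun w => g (s w)) μ :=
  Integrable.of_bound ((map_continuous g).comp hs).aestronglyMeasurable ‖g‖
    (Eventually.of_forall fun w => g.toBCF.norm_coe_le_norm (s w))

theorem continuous_integral_comp (g : C0Half) (μ : Measure ℝ) [IsFiniteMeasure μ]
    {s : ℝ → ℝ≥0} (hs : Continuous s) :
    Continuous fun x : ℝ≥0 => ∫ w, g (s (x + w)) ∂μ := by
  refine continuous_of_dominated (bound := fun _ => ‖g‖) (fun x => ?_) (fun x => ?_)
    (integrable_const _) (Eventually.of_forall fun w => ?_)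
  · exact (integrable_comp g μ (hs.comp (by fun_prop : Continuous fun w : ℝ => (x : ℝ) + w))).1
  · exact Eventually.of_forall fun w => g.toBCF.norm_coe_le_norm _
  · exact (map_continuous g).comp (hs.comp (by fun_prop))

theorem tendsto_integral_comp (g : C0Half) (μ : Measure ℝ) [IsFiniteMeasure μ]
    {s : ℝ → ℝ≥0} (hs : Continuous s) {c : ℝ}
    (h : Tendsto (fun z => g (s z)) atTop (𝓝 c)) :
    Tendsto (fun x : ℝ≥0 => ∫ w, g (s (x + w)) ∂μ) (cocompact ℝ≥0) (𝓝 (∫ _, c ∂μ)) := by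
  rw [cocompact_eq_atTop]
  refine tendsto_integral_filter_of_dominated_convergence (fun _ => ‖g‖)
    (Eventually.of_forall fun x => ?_) (Eventually.of_forall fun x => ?_)
    (integrable_const _) (Eventually.of_forall fun w => ?_)
  · exact (integrable_comp g μ (hs.comp (by fun_prop : Continuous fun w : ℝ => (x : ℝ) + w))).1
  · exact Eventually.of_forall fun w => g.toBCF.norm_coe_le_norm _
  · exact h.comp (tendsto_atTop_add_const_right _ _ (NNReal.tendsto_coe_atTop.2 tendsto_id))

theorem tendsto_comp_atTop (g : C0Half) {s : ℝ → ℝ≥0} (hs : Tendsto s atTop atTop) :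
    Tendsto (fun z => g (s z)) atTop (𝓝 0) := by
  have := zero_at_infty g
  rw [cocompact_eq_atTop] at this
  exact this.comp hs

theorem continuous_nnabs : Continuous Real.nnabs :=
  continuous_abs.subtype_mk _

theorem tendsto_nnabs : Tendsto Real.nnabs atTop atTop :=
  NNReal.tendsto_coe_atTop.1 (tendsto_abs_atTop_atTop.congr fun x => (Real.coe_nnabs x).symm)

/-- The semigroup of the reflecting Brownian motion on `[0, ∞)`:
`T_ref(t) f (x) = E f(|x + w(t)|)`, where `w(t)` is normal with mean `0` and variance `t`. -/
noncomputable def reflectingSemigroup (t : ℝ≥0) : C0Half →ₗ[ℝ] C0Half where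
  toFun f :=
    { toFun := fun x => ∫ w, f (Real.nnabs (x + w)) ∂(gaussianReal 0 t)
      continuous_toFun := continuous_integral_comp f _ continuous_nnabs
      zero_at_infty' := by
        simpa using tendsto_integral_comp f (gaussianReal 0 t) continuous_nnabs
          (tendsto_comp_atTop f tendsto_nnabs) }
  map_add' f g := by
    ext x
    exact integral_add
      (integrable_comp f _ (continuous_nnabs.comp (by fun_prop)))
      (integrable_comp g _ (continuous_nnabs.comp (by fun_prop)))
  map_smul' c f := by
    ext x
    exact integral_const_mul c _

theorem continuous_pos : Continuous Real.toNNReal := by fun_prop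

theorem continuous_neg_part : Continuous fun z : ℝ => Real.toNNReal (-z) := by fun_prop

theorem integrable_pos (g : C0Half) (t : ℝ≥0) (x : ℝ) :
    Integrable (fun w => g (Real.toNNReal (x + w))) (gaussianReal 0 t) :=
  integrable_comp g _ (by fun_prop)

theorem integrable_neg_part (g : C0Half) (t : ℝ≥0) (x : ℝ) :
    Integrable (fun w => g (Real.toNNReal (-(x + w)))) (gaussianReal 0 t) :=
  integrable_comp g _ (by fun_prop)

/-- The semigroup of the minimal Brownian motion on `(0, ∞)` (killed at the first hitting of `0`):
`T_min(t) g (x) = E g°(x + w(t))`, where `w(t)` is normal with mean `0` and variance `t`, and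
`g°(z) = g(z⁺) - g(z⁻)` is the odd extension of `g ∈ C₀(0, ∞)` to the real line
(reflection principle). -/
noncomputable def minimalSemigroup (t : ℝ≥0) : C0Open →ₗ[ℝ] C0Open where
  toFun g :=
    ⟨{ toFun := fun x =>
        ∫ w, (g.1 (Real.toNNReal (x + w)) - g.1 (Real.toNNReal (-(x + w)))) ∂(gaussianReal 0 t)
       continuous_toFun := by
        simp only [integral_sub (integrable_pos _ _ _) (integrable_neg_part _ _ _)]
        exact (continuous_integral_comp g.1 _ continuous_pos).sub
          (continuous_integral_comp g.1 _ continuous_neg_part)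
       zero_at_infty' := by
        simp only [integral_sub (integrable_pos _ _ _) (integrable_neg_part _ _ _)]
        have h1 := tendsto_integral_comp g.1 (gaussianReal 0 t) continuous_pos
          (tendsto_comp_atTop g.1 tendsto_real_toNNReal_atTop)
        have h2 := tendsto_integral_comp g.1 (gaussianReal 0 t) continuous_neg_part
          (c := 0) (by
            refine tendsto_const_nhds.congr' ?_
            filter_upwards [eventually_ge_atTop 0] with z hz
            rw [Real.toNNReal_of_nonpos (by linarith)]
            exact g.2.symm)
        simpa using h1.sub h2 }, by
      change ∫ w, (g.1 (Real.toNNReal (((0 : ℝ≥0) : ℝ) + w)) -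
        g.1 (Real.toNNReal (-(((0 : ℝ≥0) : ℝ) + w)))) ∂(gaussianReal 0 t) = 0
      rw [integral_sub (integrable_pos _ _ _) (integrable_neg_part _ _ _), sub_eq_zero]
      simp only [NNReal.coe_zero, zero_add]
      have h := gaussianReal_map_neg (μ := 0) (v := t)
      rw [neg_zero] at h
      conv_lhs => rw [← h]
      exact integral_map (by fun_prop)
        ((map_continuous g.1).comp continuous_pos).aestronglyMeasurable⟩
  map_add' f g := by
    ext x
    change ∫ w, ((f.1 _ + g.1 _) - (f.1 _ + g.1 _)) ∂(gaussianReal 0 t) =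
      (∫ w, (f.1 _ - f.1 _) ∂(gaussianReal 0 t)) + ∫ w, (g.1 _ - g.1 _) ∂(gaussianReal 0 t)
    refine Eq.trans ?_ (integral_add ((integrable_pos f.1 t x).sub (integrable_neg_part f.1 t x))
      ((integrable_pos g.1 t x).sub (integrable_neg_part g.1 t x)))
    congr 1
    funext w
    change _ = (f.1 _ - f.1 _) + (g.1 _ - g.1 _)
    ring
  map_smul' c f := by
    ext x
    change ∫ w, (c * f.1 _ - c * f.1 _) ∂(gaussianReal 0 t) =
      c * ∫ w, (f.1 _ - f.1 _) ∂(gaussianReal 0 t)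
    rw [← integral_const_mul]
    simp only [mul_sub]

/-- The mean `f̄ = ∑ j, α j f j` of `f ∈ C₀(S_k)`. -/
noncomputable def starMean (α : Fin k → ℝ) : C0Star k →ₗ[ℝ] C0Half :=
  (∑ j, α j • LinearMap.proj j) ∘ₗ (C0Star k).subtype

theorem starMean_apply (α : Fin k → ℝ) (f : C0Star k) (x : ℝ≥0) :
    starMean α f x = ∑ j, α j * f.1 j x := by
  have : starMean α f = ∑ j, α j • f.1 j := by
    simp [starMean]
  rw [this]
  induction (Finset.univ : Finset (Fin k)) using Finset.induction_on with
  | empty => simp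
  | insert i s hi ih => rw [Finset.sum_insert hi, Finset.sum_insert hi, ← ih]; rfl

theorem sub_starMean_mem {α : Fin k → ℝ} (hα : ∑ j, α j = 1) (f : C0Star k) (j : Fin k) :
    f.1 j - starMean α f ∈ C0Open := by
  change f.1 j 0 - starMean α f 0 = 0
  have h : ∀ i, f.1 i 0 = f.1 j 0 := fun i => f.2 i j
  simp only [starMean_apply, h, ← Finset.sum_mul, hα, one_mul, sub_self]

/-- The edge `j` of `f - I f̄`, as an element of `C₀(0, ∞)`. -/
noncomputable def centredEdge (α : Fin k → ℝ) (hα : ∑ j, α j = 1) (j : Fin k) :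
    C0Star k →ₗ[ℝ] C0Open :=
  LinearMap.codRestrict C0Open (LinearMap.proj j ∘ₗ (C0Star k).subtype - starMean α)
    fun f => sub_starMean_mem hα f j

/-- The Feller semigroup of Walsh's spider process with parameters `α`:
`T_α(t) f = T_min(t) (f - I f̄) + I T_ref(t) f̄`, where `f̄ = ∑ j, α j f j`, where `I g` is the
sequence with all terms equal to `g`, and where `T_min(t)` acts on each edge separately. -/
noncomputable def walshSemigroup (α : Fin k → ℝ) (hα : ∑ j, α j = 1) (t : ℝ≥0) :
    C0Star k →ₗ[ℝ] C0Star k :=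
  LinearMap.codRestrict (C0Star k)
    (LinearMap.pi fun j =>
      C0Open.subtype ∘ₗ minimalSemigroup t ∘ₗ centredEdge α hα j +
        reflectingSemigroup t ∘ₗ starMean α)
    fun f i j => by
      change (minimalSemigroup t (centredEdge α hα i f)).1 0 + _ =
        (minimalSemigroup t (centredEdge α hα j f)).1 0 + _
      have h : ∀ g : C0Open, g.1 0 = 0 := fun g => g.2
      rw [h, h]

/-- The generator `G_α` of the Feller semigroup of Walsh's spider process. -/
noncomputable def walshGenerator (α : Fin k → ℝ) (hα : ∑ j, α j = 1) :
    C0Star k →ₗ.[ℝ] C0Star k :=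
  generator (E := C0Star k) (walshSemigroup α hα)

end WalshSpider

/-!
The semigroup generated by `A_α` is written down explicitly. An element `ψ` of `L¹(S_k)` is
extended to a `k`-tuple of functions on the line by putting `2 α_j ∑ i, ψ i (-x) - ψ j (-x)` at
`x < 0` on the edge `j` (`starExt`). The tuples that arise in this way are those with
`F j + F j (- ·) = 2 α_j ∑ i, F i`, a relation which the heat semigroup preserves, since it commutes
with reflection. Hence extending, applying the heat semigroup of `L¹(ℝ)`, and restricting to the
edges is a strongly continuous semigroup (`walshDualSemigroup`). It is positive because the Gaussian
density at `y - x` exceeds that at `y + x` for `x, y ≥ 0` (`res_heat_reflection_le`), and it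
preserves the integral because the sum of the extensions is even.

Its generator `G` extends `A_α`: the boundary conditions in the domain of `A_α` say that the
extensions belong to `W^{2,1}(ℝ)`, where the second difference of a function is an average of
translates of its second derivative, and translation is continuous in `L¹(ℝ)`
(`HasSecondDerivLine.tendsto_heat`, `walshDualGraph_le`). Equality follows from two facts.
`1/2 - A_α` is surjective: convolution of the extensions with the Green function `exp (-|s|) / 2`
solves the resolvent equation, and inherits the boundary conditions from the relation above
(`exists_mem_walshDualGraph`). `1/2 - G` is injective: the extension intertwines the semigroup with
the contractive heat semigroup (`eq_zero_of_mem_generatorGraph`).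

Walsh's semigroup has the same structure: it extends each edge of `f ∈ C₀(S_k)` to the line by
`2 f̄ (-x) - f j (-x)` and applies the heat semigroup (`walshSemigroup_apply`). Fubini's theorem and
the symmetry of the Gaussian measure then make the two semigroups dual to each other
(`sum_c0Pairing_walshSemigroup`); the duality of the generators is the derivative of this at
`t = 0`.
-/

namespace WalshSpider

/-! ### Translations and Gaussian averages in `L¹(ℝ)` -/

/-- `L¹(ℝ)`, in which the functions on the edges of the star are extended to the whole line. -/
abbrev L1Line : Type := Lp ℝ 1 (volume : Measure ℝ)

/-- The functional `f ↦ ∫ h f` on `L¹(μ)` given by a bounded measurable function `h`. -/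
noncomputable def pairing {X : Type*} [MeasurableSpace X] (μ : Measure X) (h : X → ℝ)
    (hm : Measurable h) (C : ℝ) (hC : ∀ x, |h x| ≤ C) : Lp ℝ 1 μ →L[ℝ] ℝ :=
  LinearMap.mkContinuous
    { toFun := fun f => ∫ x, h x * f x ∂μ
      map_add' := fun f g => by
        rw [← integral_add ((L1.integrable_coeFn f).bdd_mul hm.aestronglyMeasurable
            (Eventually.of_forall hC))
          ((L1.integrable_coeFn g).bdd_mul hm.aestronglyMeasurable (Eventually.of_forall hC))]
        refine integral_congr_ae ?_
        filter_upwards [Lp.coeFn_add f g] with x hx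
        rw [hx, Pi.add_apply, mul_add]
      map_smul' := fun c f => by
        rw [RingHom.id_apply, smul_eq_mul, ← integral_const_mul]
        refine integral_congr_ae ?_
        filter_upwards [Lp.coeFn_smul c f] with x hx
        rw [hx, Pi.smul_apply, smul_eq_mul]
        ring } C fun f => by
    change ‖∫ x, h x * f x ∂μ‖ ≤ _
    rw [L1.norm_eq_integral_norm, ← integral_const_mul]
    refine norm_integral_le_of_norm_le ((L1.integrable_coeFn f).norm.const_mul C)
      (Eventually.of_forall fun x => ?_)
    rw [norm_mul]
    exact mul_le_mul_of_nonneg_right (hC x) (norm_nonneg _)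

theorem pairing_apply {X : Type*} [MeasurableSpace X] (μ : Measure X) (h : X → ℝ)
    (hm : Measurable h) (C : ℝ) (hC : ∀ x, |h x| ≤ C) (f : Lp ℝ 1 μ) :
    pairing μ h hm C hC f = ∫ x, h x * f x ∂μ := rfl

theorem norm_pairing_le {X : Type*} [MeasurableSpace X] (μ : Measure X) (h : X → ℝ)
    (hm : Measurable h) {C : ℝ} (hC : ∀ x, |h x| ≤ C) (h0 : 0 ≤ C) : ‖pairing μ h hm C hC‖ ≤ C := by
  unfold pairing
  exact LinearMap.mkContinuous_norm_le _ h0 _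

/-- The translation `f ↦ f (w + ·)` of `L¹(ℝ)`. -/
noncomputable def translation (w : ℝ) : L1Line →L[ℝ] L1Line :=
  (Lp.compMeasurePreservingₗᵢ ℝ (w + ·)
    (measurePreserving_add_left volume w)).toContinuousLinearMap

/-- The reflection `f ↦ f (- ·)` of `L¹(ℝ)`. -/
noncomputable def reflection : L1Line →L[ℝ] L1Line :=
  (Lp.compMeasurePreservingₗᵢ ℝ (fun x : ℝ => -x)
    (Measure.measurePreserving_neg volume)).toContinuousLinearMap

theorem coeFn_translation (w : ℝ) (f : L1Line) :
    translation w f =ᵐ[volume] fun x => f (w + x) :=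
  Lp.coeFn_compMeasurePreserving f (measurePreserving_add_left volume w)

theorem coeFn_reflection (f : L1Line) : reflection f =ᵐ[volume] fun x => f (-x) :=
  Lp.coeFn_compMeasurePreserving f (Measure.measurePreserving_neg volume)

theorem norm_translation (w : ℝ) (f : L1Line) : ‖translation w f‖ = ‖f‖ :=
  Lp.norm_compMeasurePreserving f (measurePreserving_add_left volume w)

theorem continuous_translation (f : L1Line) : Continuous fun w => translation w f := by
  let g : C(ℝ, C(ℝ, ℝ)) := (ContinuousMap.mk (fun a : ℝ × ℝ => a.1 + a.2) continuous_add).curry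
  exact Continuous.compMeasurePreservingLp (p := 1) (f := fun _ => f) (g := g) (by fun_prop)
    g.continuous (fun w => measurePreserving_add_left volume w) (by simp)

theorem translation_zero (f : L1Line) : translation 0 f = f := by
  refine Lp.ext ?_
  filter_upwards [coeFn_translation 0 f] with x hx
  rw [hx, zero_add]

theorem translation_translation (v w : ℝ) (f : L1Line) :
    translation v (translation w f) = translation (v + w) f := by
  refine Lp.ext ?_
  filter_upwards [coeFn_translation v (translation w f), coeFn_translation (v + w) f,
    (measurePreserving_add_left volume v).quasiMeasurePreserving.ae (coeFn_translation w f)]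
    with x h1 h2 h3
  rw [h1, h2, h3]
  congr 1
  ring

theorem reflection_reflection (f : L1Line) : reflection (reflection f) = f := by
  refine Lp.ext ?_
  filter_upwards [coeFn_reflection (reflection f),
    (Measure.measurePreserving_neg (volume : Measure ℝ)).quasiMeasurePreserving.ae
      (coeFn_reflection f)] with x h1 h2
  rw [h1, h2, neg_neg]

theorem reflection_translation (w : ℝ) (f : L1Line) :
    reflection (translation w f) = translation (-w) (reflection f) := by
  refine Lp.ext ?_
  filter_upwards [coeFn_reflection (translation w f), coeFn_translation (-w) (reflection f),
    (Measure.measurePreserving_neg (volume : Measure ℝ)).quasiMeasurePreserving.ae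
      (coeFn_translation w f),
    (measurePreserving_add_left volume (-w)).quasiMeasurePreserving.ae (coeFn_reflection f)]
    with x h1 h2 h3 h4
  rw [h1, h2, h3, h4]
  congr 1
  ring

section Average

variable {μ : Measure ℝ} {c : ℝ → ℝ}

theorem integrable_smul_translation (hc : Integrable c μ) (f : L1Line) :
    Integrable (fun w => c w • translation w f) μ := by
  refine (hc.norm.mul_const ‖f‖).mono' (hc.1.smul (continuous_translation f).aestronglyMeasurable)
    (Eventually.of_forall fun w => ?_)
  rw [norm_smul, norm_translation]

theorem integrable_translation [IsFiniteMeasure μ] (f : L1Line) :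
    Integrable (fun w => translation w f) μ := by
  simpa using integrable_smul_translation (μ := μ) (integrable_const (1 : ℝ)) f

theorem integrable_prod_translation [SFinite μ] (hc : Integrable c μ) (f : L1Line) :
    Integrable (fun p : ℝ × ℝ => c p.1 * f (p.1 + p.2)) (μ.prod volume) :=
  (measurePreserving_prod_add μ volume).integrable_comp_of_integrable
    (hc.mul_prod (L1.integrable_coeFn f))

/-- Fubini's theorem for a weighted average of translates, tested against a bounded function. -/
theorem integral_mul_integral_translation [SFinite μ] (hc : Integrable c μ) (f : L1Line)
    {h : ℝ → ℝ} (hm : Measurable h) {C : ℝ} (hC : ∀ x, |h x| ≤ C) :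
    ∫ x, h x * (∫ w, c w • translation w f ∂μ : L1Line) x =
      ∫ x, h x * ∫ w, c w * f (w + x) ∂μ := by
  have h1 : ∀ w, pairing volume h hm C hC (c w • translation w f) =
      ∫ x, h x * (c w * f (w + x)) := fun w => by
    rw [pairing_apply]
    refine integral_congr_ae ?_
    filter_upwards [Lp.coeFn_smul (c w) (translation w f), coeFn_translation w f] with x h1 h2
    rw [h1, Pi.smul_apply, h2, smul_eq_mul]
  have h2 : Integrable (fun p : ℝ × ℝ => h p.2 * (c p.1 * f (p.1 + p.2))) (μ.prod volume) :=
    (integrable_prod_translation hc f).bdd_mul (hm.comp measurable_snd).aestronglyMeasurable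
      (Eventually.of_forall fun p => hC p.2)
  rw [← pairing_apply volume h hm C hC,
    ← ContinuousLinearMap.integral_comp_comm _ (integrable_smul_translation hc f)]
  simp only [h1, ← integral_const_mul]
  exact integral_integral_swap h2

/-- A Bochner integral of translates is, almost everywhere, the pointwise integral. -/
theorem coeFn_integral_translation [SFinite μ] (hc : Integrable c μ) (f : L1Line) :
    (∫ w, c w • translation w f ∂μ : L1Line) =ᵐ[volume] fun x => ∫ w, c w * f (w + x) ∂μ := by
  refine Integrable.ae_eq_of_forall_setIntegral_eq _ _ (L1.integrable_coeFn _)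
    (integrable_prod_translation hc f).integral_prod_right fun s hs _ => ?_
  have := integral_mul_integral_translation hc f (h := s.indicator 1) (C := 1)
    (measurable_one.indicator hs) fun x => by
      by_cases hx : x ∈ s <;> simp [hx]
  rw [← integral_indicator hs, ← integral_indicator hs]
  refine Eq.trans ?_ (this.trans ?_) <;>
  · congr 1
    ext x
    by_cases hx : x ∈ s <;> simp [hx]

end Average

/-- The heat semigroup `f ↦ E f (w(t) + ·)` in `L¹(ℝ)`, as a Bochner integral of translates. -/
noncomputable def heat (t : ℝ≥0) : L1Line →L[ℝ] L1Line :=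
  LinearMap.mkContinuous
    { toFun := fun f => ∫ w, translation w f ∂(gaussianReal 0 t)
      map_add' := fun f g => by
        simp only [_root_.map_add]
        exact integral_add (integrable_translation f) (integrable_translation g)
      map_smul' := fun c f => by
        simp only [_root_.map_smul, RingHom.id_apply]
        exact integral_smul c _ } 1 fun f => by
    change ‖∫ w, translation w f ∂(gaussianReal 0 t)‖ ≤ _
    refine (norm_integral_le_of_norm_le_const (C := ‖f‖)
      (Eventually.of_forall fun w => (norm_translation w f).le)).trans ?_
    simp

theorem heat_apply (t : ℝ≥0) (f : L1Line) :
    heat t f = ∫ w, translation w f ∂(gaussianReal 0 t) := rfl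

theorem norm_heat_le (t : ℝ≥0) (f : L1Line) : ‖heat t f‖ ≤ ‖f‖ := by
  simpa using (heat t).le_of_opNorm_le (LinearMap.mkContinuous_norm_le _ zero_le_one _) f

theorem coeFn_heat (t : ℝ≥0) (f : L1Line) :
    heat t f =ᵐ[volume] fun x => ∫ w, f (w + x) ∂(gaussianReal 0 t) := by
  simpa [heat_apply] using
    coeFn_integral_translation (μ := gaussianReal 0 t) (integrable_const (1 : ℝ)) f

theorem heat_zero (f : L1Line) : heat 0 f = f := by
  rw [heat_apply, gaussianReal_zero_var, integral_dirac, translation_zero]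

theorem heat_heat (s t : ℝ≥0) (f : L1Line) : heat s (heat t f) = heat (s + t) f := by
  have h := gaussianReal_conv_gaussianReal (m₁ := 0) (m₂ := 0) (v₁ := s) (v₂ := t)
  rw [zero_add] at h
  rw [heat_apply (s + t), ← h, integral_conv (integrable_translation f), heat_apply s]
  refine integral_congr_ae (Eventually.of_forall fun v => ?_)
  simp only [heat_apply]
  rw [← ContinuousLinearMap.integral_comp_comm _ (integrable_translation f)]
  simp only [translation_translation]

theorem integral_gaussianReal_neg {G : Type*} [NormedAddCommGroup G] [NormedSpace ℝ G] (t : ℝ≥0)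
    (g : ℝ → G) : ∫ w, g (-w) ∂(gaussianReal 0 t) = ∫ w, g w ∂(gaussianReal 0 t) := by
  have h := gaussianReal_map_neg (μ := 0) (v := t)
  rw [neg_zero] at h
  conv_rhs => rw [← h]
  exact ((MeasurableEquiv.neg ℝ).measurableEmbedding.integral_map g).symm

theorem reflection_heat (t : ℝ≥0) (f : L1Line) :
    reflection (heat t f) = heat t (reflection f) := by
  rw [heat_apply, heat_apply,
    ← ContinuousLinearMap.integral_comp_comm _ (integrable_translation f)]
  simp only [reflection_translation]
  exact integral_gaussianReal_neg t fun w => translation w (reflection f)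

/-- Brownian scaling. -/
theorem heat_eq_integral_standard (t : ℝ≥0) (f : L1Line) :
    heat t f = ∫ z, translation (√t * z) f ∂(gaussianReal 0 1) := by
  have h := gaussianReal_map_const_mul (μ := 0) (v := 1) (√t)
  have ht : NNReal.mk (√t ^ 2) (sq_nonneg _) * 1 = t := by
    ext
    simp
  rw [mul_zero, ht] at h
  rw [heat_apply, ← h]
  exact integral_map (by fun_prop) (continuous_translation f).aestronglyMeasurable

theorem continuous_heat (f : L1Line) : Continuous fun t => heat t f := by
  simp only [heat_eq_integral_standard]
  refine continuous_of_dominated (bound := fun _ => ‖f‖) (fun t => ?_) (fun t => ?_)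
    (integrable_const _) (Eventually.of_forall fun z => ?_)
  · exact ((continuous_translation f).comp (by fun_prop)).aestronglyMeasurable
  · exact Eventually.of_forall fun z => (norm_translation _ f).le
  · exact (continuous_translation f).comp (by fun_prop)

/-- The heat semigroup is symmetric with respect to the pairing of `L¹` and `L^∞`. -/
theorem integral_mul_heat (t : ℝ≥0) (f : L1Line) {h : ℝ → ℝ} (hm : Measurable h) {C : ℝ}
    (hC : ∀ x, |h x| ≤ C) :
    ∫ x, h x * heat t f x = ∫ x, (∫ w, h (x + w) ∂(gaussianReal 0 t)) * f x := by
  have h1 : ∀ w, pairing volume h hm C hC (translation w f) = ∫ x, h (x - w) * f x := fun w => by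
    rw [pairing_apply, ← integral_add_left_eq_self (fun x => h (x - w) * f x) w]
    refine integral_congr_ae ?_
    filter_upwards [coeFn_translation w f] with x hx
    rw [hx, add_sub_cancel_left]
  have h2 : Integrable (fun p : ℝ × ℝ => h (p.2 + p.1) * f p.2)
      ((gaussianReal 0 t).prod volume) := by
    have := ((integrable_const (μ := gaussianReal 0 t) (1 : ℝ)).mul_prod (L1.integrable_coeFn f))
    simp only [one_mul] at this
    exact this.bdd_mul (hm.comp (by fun_prop)).aestronglyMeasurable
      (Eventually.of_forall fun p => hC _)
  rw [← pairing_apply volume h hm C hC, heat_apply,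
    ← ContinuousLinearMap.integral_comp_comm _ (integrable_translation f)]
  simp only [h1]
  rw [← integral_gaussianReal_neg]
  simp only [sub_neg_eq_add]
  rw [integral_integral_swap h2]
  simp only [integral_mul_const]

theorem integral_heat (t : ℝ≥0) (f : L1Line) : ∫ x, heat t f x = ∫ x, f x := by
  simpa using integral_mul_heat t f (h := fun _ => 1) measurable_const (C := 1) (by simp)

/-! ### Extension from the half-line to the line -/

theorem integrable_indicator_halfLine (u : L1Half) :
    Integrable ((Ici (0 : ℝ)).indicator u) volume :=
  (integrable_indicator_iff measurableSet_Ici).2 (L1.integrable_coeFn u)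

/-- Extension by zero, from `L¹(ℝ⁺)` to `L¹(ℝ)`. -/
noncomputable def zeroExt : L1Half →L[ℝ] L1Line :=
  LinearMap.mkContinuous
    { toFun := fun u => (integrable_indicator_halfLine u).toL1
      map_add' := fun u v => by
        rw [← Integrable.toL1_add, Integrable.toL1_eq_toL1_iff]
        have h := (ae_restrict_iff' measurableSet_Ici).1 (Lp.coeFn_add u v)
        filter_upwards [h] with x hx
        by_cases hx0 : x ∈ Ici (0 : ℝ)
        · simpa [indicator_of_mem hx0] using hx hx0
        · simp [indicator_of_notMem hx0]
      map_smul' := fun c u => by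
        rw [RingHom.id_apply, ← Integrable.toL1_smul, Integrable.toL1_eq_toL1_iff]
        have h := (ae_restrict_iff' measurableSet_Ici).1 (Lp.coeFn_smul c u)
        filter_upwards [h] with x hx
        by_cases hx0 : x ∈ Ici (0 : ℝ)
        · simpa [indicator_of_mem hx0] using hx hx0
        · simp [indicator_of_notMem hx0] } 1 fun u => by
    simp only [LinearMap.coe_mk, AddHom.coe_mk, one_mul]
    rw [L1.norm_of_fun_eq_integral_norm, L1.norm_eq_integral_norm,
      ← integral_indicator measurableSet_Ici]
    simp only [norm_indicator_eq_indicator_norm]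
    exact le_rfl

theorem coeFn_zeroExt (u : L1Half) : zeroExt u =ᵐ[volume] (Ici (0 : ℝ)).indicator u :=
  Integrable.coeFn_toL1 (integrable_indicator_halfLine u)

/-- Restriction to the half-line, from `L¹(ℝ)` to `L¹(ℝ⁺)`. -/
noncomputable def res : L1Line →L[ℝ] L1Half :=
  LpToLpRestrictCLM ℝ ℝ ℝ volume 1 (Ici 0)

theorem coeFn_res (f : L1Line) : res f =ᵐ[halfLine] f :=
  LpToLpRestrictCLM_coeFn ℝ (Ici 0) f

theorem ae_halfLine_iff {p : ℝ → Prop} :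
    (∀ᵐ x ∂halfLine, p x) ↔ ∀ᵐ x ∂volume, 0 ≤ x → p x :=
  ae_restrict_iff' measurableSet_Ici

theorem ae_neg {p : ℝ → Prop} (h : ∀ᵐ x ∂(volume : Measure ℝ), p x) :
    ∀ᵐ x ∂(volume : Measure ℝ), p (-x) :=
  (Measure.measurePreserving_neg (volume : Measure ℝ)).quasiMeasurePreserving.ae h

theorem ae_line_of_halfLine {p : ℝ → Prop} (h1 : ∀ᵐ x ∂halfLine, p x)
    (h2 : ∀ᵐ x ∂halfLine, p (-x)) : ∀ᵐ x ∂(volume : Measure ℝ), p x := by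
  filter_upwards [ae_halfLine_iff.1 h1, ae_neg (ae_halfLine_iff.1 h2)] with x h1 h2
  rcases le_total 0 x with hx | hx
  · exact h1 hx
  · simpa using h2 (by linarith)

theorem coeFn_zeroExt_neg (u : L1Half) : ∀ᵐ x ∂halfLine, zeroExt u (-x) = 0 := by
  refine ae_halfLine_iff.2 ?_
  filter_upwards [ae_neg (coeFn_zeroExt u), Measure.ae_ne volume (0 : ℝ)] with x h1 h2 hx
  rw [h1, indicator_of_notMem]
  simpa using lt_of_le_of_ne hx h2.symm

theorem coeFn_zeroExt_pos (u : L1Half) : ∀ᵐ x ∂halfLine, zeroExt u x = u x := by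
  refine ae_halfLine_iff.2 ?_
  filter_upwards [coeFn_zeroExt u] with x h1 hx
  rw [h1, indicator_of_mem (show x ∈ Ici (0 : ℝ) from hx)]

/-- The function on the line equal to `u` on the right and to `x ↦ u' (-x)` on the left. -/
noncomputable def glue (u u' : L1Half) : L1Line := zeroExt u + reflection (zeroExt u')

theorem coeFn_glue_pos (u u' : L1Half) : ∀ᵐ x ∂halfLine, glue u u' x = u x := by
  filter_upwards [ae_restrict_of_ae (Lp.coeFn_add (zeroExt u) (reflection (zeroExt u'))),
    ae_restrict_of_ae (coeFn_reflection (zeroExt u')), coeFn_zeroExt_pos u, coeFn_zeroExt_neg u']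
    with x h1 h2 h3 h4
  rw [glue, h1, Pi.add_apply, h2, h3, h4, add_zero]

theorem coeFn_glue_neg (u u' : L1Half) : ∀ᵐ x ∂halfLine, glue u u' (-x) = u' x := by
  filter_upwards [ae_restrict_of_ae (ae_neg (Lp.coeFn_add (zeroExt u) (reflection (zeroExt u')))),
    ae_restrict_of_ae (ae_neg (coeFn_reflection (zeroExt u'))), coeFn_zeroExt_neg u,
    coeFn_zeroExt_pos u'] with x h1 h2 h3 h4
  rw [glue, h1, Pi.add_apply, h2, h3, neg_neg, h4, zero_add]

theorem res_glue (u u' : L1Half) : res (glue u u') = u := by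
  refine Lp.ext ?_
  filter_upwards [coeFn_res (glue u u'), coeFn_glue_pos u u'] with x h1 h2
  rw [h1, h2]

theorem glue_res (f : L1Line) : glue (res f) (res (reflection f)) = f := by
  refine Lp.ext (ae_line_of_halfLine ?_ ?_)
  · filter_upwards [coeFn_glue_pos (res f) (res (reflection f)), coeFn_res f] with x h1 h2
    rw [h1, h2]
  · filter_upwards [coeFn_glue_neg (res f) (res (reflection f)), coeFn_res (reflection f),
      ae_restrict_of_ae (coeFn_reflection f)] with x h1 h2 h3
    rw [h1, h2, h3]

theorem integral_glue (u u' : L1Half) :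
    ∫ x, glue u u' x = (∫ x in Ici (0 : ℝ), u x) + ∫ x in Ici (0 : ℝ), u' x := by
  have h : ∀ u : L1Half, ∫ x, zeroExt u x = ∫ x in Ici (0 : ℝ), u x := fun u => by
    rw [integral_congr_ae (coeFn_zeroExt u), integral_indicator measurableSet_Ici]
  rw [glue, integral_congr_ae (Lp.coeFn_add _ _), ← h u, ← h u']
  simp only [Pi.add_apply]
  rw [integral_add (L1.integrable_coeFn _) (L1.integrable_coeFn _),
    integral_congr_ae (coeFn_reflection (zeroExt u')),
    integral_neg_eq_self (fun x => zeroExt u' x) volume]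

/-! ### The semigroup in `L¹(S_k)` -/

variable {k : ℕ}

/-- Summation over the edges, from `L¹(S_k)` to `L¹(ℝ⁺)`. -/
noncomputable def edgeSum : L1Star k →L[ℝ] L1Half := ∑ i, PiLp.proj 1 (fun _ => L1Half) i

theorem edgeSum_apply (ψ : L1Star k) : edgeSum ψ = ∑ i, ψ i := by
  simp [edgeSum]

/-- The extension of `ψ ∈ L¹(S_k)` to a `k`-tuple of functions on the line. On the negative
half-line the `j`-th one is the reflection of `2 α_j ∑ i, ψ i - ψ j`; the values on the left are
chosen so that the extensions of elements of `L¹(S_k)` are invariant under the heat semigroup. -/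
noncomputable def starExt (α : Fin k → ℝ) (j : Fin k) : L1Star k →L[ℝ] L1Line :=
  zeroExt ∘L PiLp.proj 1 (fun _ => L1Half) j +
    reflection ∘L zeroExt ∘L ((2 * α j) • edgeSum - PiLp.proj 1 (fun _ => L1Half) j)

theorem starExt_apply (α : Fin k → ℝ) (j : Fin k) (ψ : L1Star k) :
    starExt α j ψ = glue (ψ j) ((2 * α j) • (∑ i, ψ i) - ψ j) := by
  simp [starExt, glue, edgeSum_apply]

theorem res_starExt (α : Fin k → ℝ) (j : Fin k) (ψ : L1Star k) : res (starExt α j ψ) = ψ j := by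
  rw [starExt_apply, res_glue]

/-- A `k`-tuple of functions on the line extends an element of `L¹(S_k)` if it satisfies the
linear relation `F j + F j (- ·) = 2 α_j ∑ i, F i`. -/
theorem starExt_res (α : Fin k → ℝ) {F : Fin k → L1Line}
    (hF : ∀ j, F j + reflection (F j) = (2 * α j) • ∑ i, F i) {ψ : L1Star k}
    (hψ : ∀ j, ψ j = res (F j)) (j : Fin k) : starExt α j ψ = F j := by
  have h : res (reflection (F j)) = (2 * α j) • (∑ i, ψ i) - ψ j := by
    have := congrArg res (hF j)
    rw [_root_.map_add, _root_.map_smul, _root_.map_sum] at this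
    simp only [hψ]
    rw [← this]
    abel
  rw [starExt_apply, ← h, hψ j, glue_res]

theorem sum_starExt {α : Fin k → ℝ} (hsum : ∑ j, α j = 1) (ψ : L1Star k) :
    ∑ i, starExt α i ψ = glue (∑ i, ψ i) (∑ i, ψ i) := by
  simp only [starExt_apply, glue, Finset.sum_add_distrib, ← _root_.map_sum,
    Finset.sum_sub_distrib, ← Finset.sum_smul, ← Finset.mul_sum, hsum]
  congr 3
  module

theorem starExt_add_reflection {α : Fin k → ℝ} (hsum : ∑ j, α j = 1) (ψ : L1Star k) (j : Fin k) :
    starExt α j ψ + reflection (starExt α j ψ) = (2 * α j) • ∑ i, starExt α i ψ := by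
  rw [sum_starExt hsum, starExt_apply]
  simp only [glue, _root_.map_add, _root_.map_sub, _root_.map_smul, reflection_reflection]
  module

/-- The semigroup in `L¹(S_k)` generated by `A_α`: extend to the line, apply the heat semigroup,
and restrict to the edges. -/
noncomputable def walshDualSemigroup (α : Fin k → ℝ) (t : ℝ≥0) : L1Star k →L[ℝ] L1Star k :=
  (PiLp.continuousLinearEquiv 1 ℝ (fun _ : Fin k => L1Half)).symm.toContinuousLinearMap ∘L
    ContinuousLinearMap.pi fun j => res ∘L heat t ∘L starExt α j

theorem walshDualSemigroup_apply (α : Fin k → ℝ) (t : ℝ≥0) (ψ : L1Star k) (j : Fin k) :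
    walshDualSemigroup α t ψ j = res (heat t (starExt α j ψ)) := rfl

theorem starExt_walshDualSemigroup {α : Fin k → ℝ} (hsum : ∑ j, α j = 1) (t : ℝ≥0)
    (ψ : L1Star k) (j : Fin k) :
    starExt α j (walshDualSemigroup α t ψ) = heat t (starExt α j ψ) := by
  refine starExt_res α (F := fun j => heat t (starExt α j ψ)) (fun j => ?_) (fun j => rfl) j
  rw [reflection_heat, ← _root_.map_add, starExt_add_reflection hsum, _root_.map_smul,
    _root_.map_sum]

theorem walshDualSemigroup_zero (α : Fin k → ℝ) :
    walshDualSemigroup α 0 = ContinuousLinearMap.id ℝ (L1Star k) := by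
  ext1 ψ
  ext1 j
  rw [walshDualSemigroup_apply, heat_zero, res_starExt]
  rfl

theorem walshDualSemigroup_add {α : Fin k → ℝ} (hsum : ∑ j, α j = 1) (s t : ℝ≥0) :
    walshDualSemigroup α (s + t) = (walshDualSemigroup α s).comp (walshDualSemigroup α t) := by
  ext1 ψ
  ext1 j
  rw [ContinuousLinearMap.comp_apply, walshDualSemigroup_apply, walshDualSemigroup_apply,
    starExt_walshDualSemigroup hsum, heat_heat]

theorem continuous_walshDualSemigroup (α : Fin k → ℝ) (ψ : L1Star k) :
    Continuous fun t => walshDualSemigroup α t ψ :=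
  (PiLp.continuousLinearEquiv 1 ℝ (fun _ : Fin k => L1Half)).symm.continuous.comp
    (continuous_pi fun _ => res.continuous.comp (continuous_heat _))

theorem gaussianPDFReal_anti {t : ℝ≥0} {x y : ℝ} (h : |x| ≤ |y|) :
    gaussianPDFReal 0 t y ≤ gaussianPDFReal 0 t x := by
  simp only [gaussianPDFReal, sub_zero]
  have := sq_le_sq.2 h
  gcongr

/-- The heat semigroup at a positive time, written with the Gaussian density; at time `0` the
measure is a point mass and has no density. -/
theorem coeFn_heat_of_ne_zero {t : ℝ≥0} (ht : t ≠ 0) (f : L1Line) :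
    heat t f =ᵐ[volume] fun x => ∫ y, gaussianPDFReal 0 t (y - x) * f y := by
  filter_upwards [coeFn_heat t f] with x hx
  rw [hx, integral_gaussianReal_eq_integral_smul ht,
    ← integral_sub_right_eq_self _ x]
  simp

theorem bdd_gaussianPDFReal (t : ℝ≥0) (x : ℝ) : ‖gaussianPDFReal 0 t x‖ ≤ gaussianPDFReal 0 t 0 := by
  rw [Real.norm_of_nonneg (gaussianPDFReal_nonneg 0 t x)]
  exact gaussianPDFReal_anti (by simp)

/-- The semigroup of the killed Brownian motion is positive, because the Gaussian density at
`y - x` exceeds that at `y + x` when `x, y ≥ 0`. -/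
theorem res_heat_reflection_le (t : ℝ≥0) {u : L1Half} (hu : 0 ≤ u) :
    res (heat t (reflection (zeroExt u))) ≤ res (heat t (zeroExt u)) := by
  -- at time `0` the claim is that the reflected function vanishes on the half-line
  rcases eq_or_ne t 0 with rfl | ht
  · have h0 : res (zeroExt u) = u := by simpa [glue] using res_glue u 0
    have h1 : res (reflection (zeroExt u)) = 0 := by simpa [glue] using res_glue 0 u
    rwa [heat_zero, heat_zero, h0, h1]
  rw [← Lp.coeFn_le]
  have hu' : ∀ᵐ y ∂volume, 0 ≤ zeroExt u y := by
    filter_upwards [coeFn_zeroExt u, ae_halfLine_iff.1 ((Lp.coeFn_nonneg u).2 hu)] with y h1 h2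
    rw [h1]
    exact indicator_apply_nonneg fun hy => h2 hy
  have hint : ∀ x, Integrable (fun y => gaussianPDFReal 0 t (y - x) * zeroExt u y) := fun x =>
    (L1.integrable_coeFn (zeroExt u)).bdd_mul
      ((measurable_gaussianPDFReal 0 t).comp (by fun_prop)).aestronglyMeasurable
      (Eventually.of_forall fun y => bdd_gaussianPDFReal t _)
  filter_upwards [coeFn_res (heat t (reflection (zeroExt u))), coeFn_res (heat t (zeroExt u)),
    ae_restrict_of_ae (coeFn_heat_of_ne_zero ht (zeroExt u)),
    ae_restrict_of_ae (ae_neg (coeFn_heat_of_ne_zero ht (zeroExt u))),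
    ae_restrict_of_ae (coeFn_reflection (heat t (zeroExt u))),
    ae_restrict_mem measurableSet_Ici] with x h1 h2 h3 h4 h5 hx
  have hx : 0 ≤ x := hx
  rw [h1, h2, ← reflection_heat, h5, h3, h4]
  refine integral_mono_ae (hint _) (hint _) ?_
  filter_upwards [hu', coeFn_zeroExt u] with y hy hy'
  by_cases hy0 : 0 ≤ y
  · refine mul_le_mul_of_nonneg_right (gaussianPDFReal_anti ?_) hy
    rw [← sq_le_sq]
    nlinarith [mul_nonneg hx hy0]
  · rw [hy', indicator_of_notMem (by simpa using hy0)]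
    simp

theorem heat_nonneg (t : ℝ≥0) {f : L1Line} (hf : 0 ≤ f) : 0 ≤ heat t f := by
  rw [← Lp.coeFn_nonneg] at hf ⊢
  rcases eq_or_ne t 0 with rfl | ht
  · rwa [heat_zero]
  filter_upwards [coeFn_heat_of_ne_zero ht f] with x hx
  rw [Pi.zero_apply, hx]
  refine integral_nonneg_of_ae ?_
  filter_upwards [hf] with y hy
  exact mul_nonneg (gaussianPDFReal_nonneg _ _ _) hy

theorem res_nonneg {f : L1Line} (hf : 0 ≤ f) : 0 ≤ res f := by
  rw [← Lp.coeFn_nonneg] at hf ⊢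
  filter_upwards [ae_restrict_of_ae hf, coeFn_res f] with x h1 h2
  rwa [h2]

theorem reflection_nonneg {f : L1Line} (hf : 0 ≤ f) : 0 ≤ reflection f := by
  rw [← Lp.coeFn_nonneg] at hf ⊢
  filter_upwards [ae_neg hf, coeFn_reflection f] with x h1 h2
  rwa [h2]

theorem smul_nonneg_of_nonneg {c : ℝ} (hc : 0 ≤ c) {u : L1Half} (hu : 0 ≤ u) : 0 ≤ c • u := by
  rw [← Lp.coeFn_nonneg] at hu ⊢
  filter_upwards [hu, Lp.coeFn_smul c u] with x h1 h2
  rw [h2]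
  exact mul_nonneg hc h1

theorem zeroExt_nonneg {u : L1Half} (hu : 0 ≤ u) : 0 ≤ zeroExt u := by
  rw [← Lp.coeFn_nonneg] at hu ⊢
  filter_upwards [coeFn_zeroExt u, ae_halfLine_iff.1 hu] with y h1 h2
  rw [h1]
  exact indicator_apply_nonneg fun hy => h2 hy

theorem walshDualSemigroup_nonneg {α : Fin k → ℝ} (hpos : ∀ j, 0 < α j) (t : ℝ≥0) {ψ : L1Star k}
    (hψ : ∀ j, 0 ≤ ψ j) (j : Fin k) : 0 ≤ walshDualSemigroup α t ψ j := by
  have h : walshDualSemigroup α t ψ j =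
      (res (heat t (zeroExt (ψ j))) - res (heat t (reflection (zeroExt (ψ j))))) +
        (2 * α j) • res (heat t (reflection (zeroExt (∑ i, ψ i)))) := by
    rw [walshDualSemigroup_apply, starExt_apply, glue]
    simp only [_root_.map_add, _root_.map_sub, _root_.map_smul]
    module
  rw [h]
  refine add_nonneg (sub_nonneg.2 (res_heat_reflection_le t (hψ j)))
    (smul_nonneg_of_nonneg (by linarith [hpos j]) ?_)
  exact res_nonneg (heat_nonneg t (reflection_nonneg (zeroExt_nonneg
    (Finset.sum_nonneg fun i _ => hψ i))))

theorem starIntegral_eq_integral_sum (ψ : L1Star k) :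
    starIntegral (fun j x => ψ j x) = ∫ x in Ici (0 : ℝ), (∑ i, ψ i : L1Half) x := by
  have h : ∀ u : L1Half, pairing halfLine (fun _ => 1) measurable_const 1 (by simp) u =
      ∫ x in Ici (0 : ℝ), u x := fun u => by simp [pairing_apply]
  rw [starIntegral, ← h, _root_.map_sum]
  simp only [h]

theorem starIntegral_walshDualSemigroup {α : Fin k → ℝ} (hsum : ∑ j, α j = 1) (t : ℝ≥0)
    (ψ : L1Star k) :
    starIntegral (fun j x => walshDualSemigroup α t ψ j x) = starIntegral (fun j x => ψ j x) := by
  -- both sides are half the integral of the sum of the extensions, which is an even function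
  have h : ∀ φ : L1Star k, ∫ x, (∑ i, starExt α i φ : L1Line) x =
      2 * starIntegral (fun j x => φ j x) := fun φ => by
    rw [sum_starExt hsum, integral_glue, starIntegral_eq_integral_sum]
    ring
  have h1 := h (walshDualSemigroup α t ψ)
  simp only [starExt_walshDualSemigroup hsum] at h1
  rw [← _root_.map_sum, integral_heat, h ψ] at h1
  linarith

theorem isMarkovSemigroup_walshDualSemigroup {α : Fin k → ℝ} (hpos : ∀ j, 0 < α j)
    (hsum : ∑ j, α j = 1) : IsMarkovSemigroup (walshDualSemigroup α) where
  map_zero := walshDualSemigroup_zero α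
  map_add := walshDualSemigroup_add hsum
  continuous := continuous_walshDualSemigroup α
  markov t :=
    { nonneg := fun _ hψ => walshDualSemigroup_nonneg hpos t hψ
      integral_eq := starIntegral_walshDualSemigroup hsum t }

/-! ### The generator of the heat semigroup -/

/-- `F` belongs to `W^{2,1}(ℝ)`, with `F(0) = a`, `F'(0) = b` and `F'' = V`; the analogue on the
line of `HasSecondDeriv`. The integral is oriented, so that the formula also holds for `x < 0`. -/
def HasSecondDerivLine (F V : L1Line) (a b : ℝ) : Prop :=
  ∀ᵐ x ∂(volume : Measure ℝ), F x = a + b * x + ∫ y in (0 : ℝ)..x, (x - y) * V y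

/-- Two halves in `W^{2,1}(ℝ⁺)` fit together to a function in `W^{2,1}(ℝ)` if the values at `0`
agree and the derivatives there are opposite. -/
theorem HasSecondDeriv.glue {u v u' v' : L1Half} {a b : ℝ} (h : HasSecondDeriv u v a b)
    (h' : HasSecondDeriv u' v' a (-b)) : HasSecondDerivLine (glue u u') (glue v v') a b := by
  refine ae_line_of_halfLine ?_ ?_
  · filter_upwards [coeFn_glue_pos u u', h, ae_restrict_mem measurableSet_Ici] with x h1 h2 hx
    rw [h1, h2, integral_kernel_congr (coeFn_glue_pos v v') hx]
  · filter_upwards [coeFn_glue_neg u u', h', ae_restrict_mem measurableSet_Ici] with x h1 h2 hx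
    have h3 := intervalIntegral.integral_comp_neg (a := 0) (b := x)
      (fun y => (-x - y) * WalshSpider.glue v v' y)
    rw [neg_zero] at h3
    rw [h1, h2, intervalIntegral.integral_symm (-x) 0, ← h3, ← intervalIntegral.integral_neg,
      ← integral_kernel_congr (coeFn_glue_neg v v') hx]
    congr 1
    · ring
    · congr 1
      ext y
      ring

theorem HasSecondDeriv.sum {ι : Type*} (s : Finset ι) {u v : ι → L1Half} {a b : ι → ℝ}
    (h : ∀ i ∈ s, HasSecondDeriv (u i) (v i) (a i) (b i)) :
    HasSecondDeriv (∑ i ∈ s, u i) (∑ i ∈ s, v i) (∑ i ∈ s, a i) (∑ i ∈ s, b i) := by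
  classical
  induction s using Finset.induction_on with
  | empty => simpa using hasSecondDeriv_zero
  | insert i s hi ih =>
    simp only [Finset.sum_insert hi]
    exact (h i (Finset.mem_insert_self i s)).add
      (ih fun j hj => h j (Finset.mem_insert_of_mem hj))

theorem intervalIntegrable_coeFn (V : L1Line) (p q : ℝ) : IntervalIntegrable V volume p q :=
  (L1.integrable_coeFn V).intervalIntegrable

/-- Taylor's formula with integral remainder for the function with second derivative `V`. -/
theorem integral_remainder (V : L1Line) (x w : ℝ) :
    ∫ s in (0 : ℝ)..w, (w - s) * V (s + x) =
      (∫ y in (0 : ℝ)..(x + w), (x + w - y) * V y) - (∫ y in (0 : ℝ)..x, (x - y) * V y) -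
        w * ∫ y in (0 : ℝ)..x, V y := by
  have hi : ∀ c p q : ℝ, IntervalIntegrable (fun y => (c - y) * V y) volume p q := fun c p q =>
    (intervalIntegrable_coeFn V p q).continuousOn_mul (by fun_prop)
  have h1 := intervalIntegral.integral_comp_add_right (a := 0) (b := w)
    (fun y => (x + w - y) * V y) x
  have h2 : ∫ s in (0 : ℝ)..w, (w - s) * V (s + x) =
      ∫ s in (0 : ℝ)..w, (x + w - (s + x)) * V (s + x) := by
    congr 1
    ext s
    ring
  have h3 : ∫ y in (0 : ℝ)..x, (x + w - y) * V y =
      (∫ y in (0 : ℝ)..x, (x - y) * V y) + w * ∫ y in (0 : ℝ)..x, V y := by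
    rw [← intervalIntegral.integral_const_mul, ← intervalIntegral.integral_add (hi _ _ _)
      ((intervalIntegrable_coeFn V _ _).const_mul w)]
    congr 1
    ext s
    ring
  rw [h2, h1, zero_add, add_comm w x,
    ← intervalIntegral.integral_add_adjacent_intervals (hi (x + w) 0 x) (hi (x + w) x (x + w)), h3]
  ring

/-- The average of the translates of `V` over `[-h, h]`, with a triangular weight. -/
noncomputable def triangleMean (V : L1Line) (h : ℝ) : L1Line :=
  ∫ r in (-1 : ℝ)..1, (1 - |r|) • translation (h * r) V

theorem triangle_weight_le {r : ℝ} (hr : r ∈ uIoc (-1 : ℝ) 1) : ‖1 - |r|‖ ≤ 1 := by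
  rw [uIoc_of_le (by norm_num)] at hr
  have : |r| ≤ 1 := abs_le.2 ⟨hr.1.le, hr.2⟩
  rw [Real.norm_eq_abs, abs_le]
  constructor <;> linarith [abs_nonneg r]

theorem norm_triangle_smul_le (V : L1Line) (h : ℝ) {r : ℝ} (hr : r ∈ uIoc (-1 : ℝ) 1) :
    ‖(1 - |r|) • translation (h * r) V‖ ≤ ‖V‖ := by
  rw [norm_smul, norm_translation]
  exact mul_le_of_le_one_left (norm_nonneg _) (triangle_weight_le hr)

theorem norm_triangleMean_le (V : L1Line) (h : ℝ) : ‖triangleMean V h‖ ≤ 2 * ‖V‖ := by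
  refine (intervalIntegral.norm_integral_le_of_norm_le_const
    fun r hr => norm_triangle_smul_le V h hr).trans_eq ?_
  norm_num
  ring

theorem continuous_triangleMean (V : L1Line) : Continuous (triangleMean V) := by
  refine intervalIntegral.continuous_of_dominated_interval (bound := fun _ => ‖V‖) (fun h => ?_)
    (fun h => Eventually.of_forall fun r hr => norm_triangle_smul_le V h hr)
    intervalIntegrable_const (Eventually.of_forall fun r _ => ?_)
  · have : Continuous fun r : ℝ => (1 - |r|) • translation (h * r) V :=
      (by fun_prop : Continuous fun r : ℝ => 1 - |r|).smul
        ((continuous_translation V).comp (continuous_const_mul h))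
    exact this.aestronglyMeasurable
  · have : Continuous fun h : ℝ => translation (h * r) V :=
      (continuous_translation V).comp (continuous_mul_const r)
    exact this.const_smul (1 - |r|)

theorem triangleMean_zero (V : L1Line) : triangleMean V 0 = V := by
  have h : ∫ r in (-1 : ℝ)..1, (1 - |r|) = 1 := by
    have hi : ∀ p q : ℝ, IntervalIntegrable (fun r : ℝ => 1 - |r|) volume p q := fun p q =>
      (by fun_prop : Continuous fun r : ℝ => 1 - |r|).intervalIntegrable p q
    rw [← intervalIntegral.integral_add_adjacent_intervals (hi (-1) 0) (hi 0 1)]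
    have h1 : ∫ r in (-1 : ℝ)..0, (1 - |r|) = ∫ r in (-1 : ℝ)..0, (1 + r) := by
      refine intervalIntegral.integral_congr fun r hr => ?_
      rw [uIcc_of_le (by norm_num)] at hr
      simp [abs_of_nonpos hr.2]
    have h2 : ∫ r in (0 : ℝ)..1, (1 - |r|) = ∫ r in (0 : ℝ)..1, (1 - r) := by
      refine intervalIntegral.integral_congr fun r hr => ?_
      rw [uIcc_of_le (by norm_num)] at hr
      simp [abs_of_nonneg hr.1]
    rw [h1, h2, intervalIntegral.integral_add (by simp) (by simp),
      intervalIntegral.integral_sub (by simp) (by simp)]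
    norm_num
  simp only [triangleMean, zero_mul, translation_zero]
  rw [intervalIntegral.integral_smul_const, h, one_smul]

/-- The symmetric second difference of an element of `W^{2,1}(ℝ)`. -/
theorem HasSecondDerivLine.second_difference {F V : L1Line} {a b : ℝ}
    (hF : HasSecondDerivLine F V a b) {w : ℝ} (hw : 0 ≤ w) :
    translation w F + translation (-w) F - (2 : ℝ) • F = w ^ 2 • triangleMean V w := by
  have hle : -w ≤ w := by linarith
  have hc : Continuous fun s : ℝ => w - |s| := by fun_prop
  have hscale : w ^ 2 • triangleMean V w =
      ∫ s in Ioc (-w) w, (w - |s|) • translation s V := by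
    have h := intervalIntegral.smul_integral_comp_mul_left (a := -1) (b := 1)
      (fun s => (w - |s|) • translation s V) w
    rw [mul_neg, mul_one, intervalIntegral.integral_of_le hle] at h
    rw [← h, sq, mul_smul, triangleMean, ← intervalIntegral.integral_smul]
    congr 2
    ext1 r
    rw [smul_smul, abs_mul, abs_of_nonneg hw]
    congr 1
    ring
  rw [hscale]
  have hint : Integrable (fun s : ℝ => w - |s|) (volume.restrict (Ioc (-w) w)) :=
    (hc.intervalIntegrable (-w) w).1
  refine Lp.ext ?_
  filter_upwards [Lp.coeFn_sub (translation w F + translation (-w) F) ((2 : ℝ) • F),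
    Lp.coeFn_add (translation w F) (translation (-w) F), Lp.coeFn_smul (2 : ℝ) F,
    coeFn_translation w F, coeFn_translation (-w) F, hF,
    (measurePreserving_add_left volume w).quasiMeasurePreserving.ae hF,
    (measurePreserving_add_left volume (-w)).quasiMeasurePreserving.ae hF,
    coeFn_integral_translation hint V] with x h1 h2 h3 h4 h5 h6 h7 h8 h9
  rw [h9, h1, Pi.sub_apply, h2, Pi.add_apply, h3, Pi.smul_apply, h4, h5, h6, h7, h8,
    smul_eq_mul, ← intervalIntegral.integral_of_le hle]
  have hi : ∀ p q : ℝ, IntervalIntegrable (fun s => (w - |s|) * V (s + x)) volume p q :=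
    fun p q => IntervalIntegrable.continuousOn_mul
      ((L1.integrable_coeFn V).comp_add_right x).intervalIntegrable hc.continuousOn
  rw [← intervalIntegral.integral_add_adjacent_intervals (hi (-w) 0) (hi 0 w)]
  have e1 : ∫ s in (0 : ℝ)..w, (w - |s|) * V (s + x) = ∫ s in (0 : ℝ)..w, (w - s) * V (s + x) := by
    refine intervalIntegral.integral_congr fun s hs => ?_
    rw [uIcc_of_le hw] at hs
    simp only [abs_of_nonneg hs.1]
  have e2 : ∫ s in (-w)..0, (w - |s|) * V (s + x) =
      ∫ s in (0 : ℝ)..(-w), (-w - s) * V (s + x) := by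
    rw [intervalIntegral.integral_symm (-w) 0, ← intervalIntegral.integral_neg]
    refine intervalIntegral.integral_congr fun s hs => ?_
    rw [uIcc_of_le (by linarith)] at hs
    simp only [abs_of_nonpos hs.2]
    ring
  rw [e1, e2, integral_remainder, integral_remainder, add_comm w x, add_comm (-w) x]
  ring

theorem integrable_sq_gaussianReal : Integrable (fun z : ℝ => z ^ 2) (gaussianReal 0 1) :=
  (memLp_id_gaussianReal (μ := 0) (v := 1) 2).integrable_sq

theorem integral_sq_gaussianReal : ∫ z, z ^ 2 ∂(gaussianReal 0 1) = 1 := by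
  have h := variance_fun_id_gaussianReal (μ := 0) (v := 1)
  rw [variance_of_integral_eq_zero (by fun_prop) (by simp)] at h
  simpa using h

theorem HasSecondDerivLine.heat_sub {F V : L1Line} {a b : ℝ} (hF : HasSecondDerivLine F V a b)
    {t : ℝ≥0} (ht : t ≠ 0) :
    (t : ℝ)⁻¹ • (heat t F - F) =
      (1 / 2 : ℝ) • ∫ z, z ^ 2 • triangleMean V (√t * |z|) ∂(gaussianReal 0 1) := by
  have hint : ∀ c : ℝ, Integrable (fun z : ℝ => translation (c * z) F) (gaussianReal 0 1) :=
    fun c => Integrable.of_bound ((continuous_translation F).comp (by fun_prop)).aestronglyMeasurable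
      ‖F‖ (Eventually.of_forall fun z => (norm_translation _ F).le)
  have h1 : heat t F = ∫ z, translation (-√t * z) F ∂(gaussianReal 0 1) := by
    rw [heat_eq_integral_standard, ← integral_gaussianReal_neg]
    simp
  -- averaging over `w` and `-w`, which have the same law, gives a second difference
  have h2 : (2 : ℝ) • (heat t F - F) =
      ∫ z, (t : ℝ) • z ^ 2 • triangleMean V (√t * |z|) ∂(gaussianReal 0 1) := by
    have h3 : (2 : ℝ) • (heat t F - F) = ∫ z, (translation (√t * z) F +
        translation (-√t * z) F - (2 : ℝ) • F) ∂(gaussianReal 0 1) := by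
      rw [integral_sub (f := fun z => translation (√t * z) F + translation (-√t * z) F)
          ((hint _).add (hint _)) (integrable_const _),
        integral_add (hint _) (hint _), ← h1, ← heat_eq_integral_standard]
      simp only [integral_const, probReal_univ, one_smul]
      module
    rw [h3]
    congr 1
    ext1 z
    have h4 := hF.second_difference (w := √t * |z|) (by positivity)
    rw [mul_pow, sq_abs, Real.sq_sqrt t.coe_nonneg, mul_smul] at h4
    rw [← h4]
    rcases abs_choice z with hz | hz <;> rw [hz]
    · rw [neg_mul]
    · rw [mul_neg, neg_neg, neg_mul, add_comm (translation (√t * z) F)]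
  rw [integral_smul] at h2
  have ht' : (t : ℝ) ≠ 0 := by simpa using ht
  rw [show heat t F - F = (1 / 2 : ℝ) • (2 : ℝ) • (heat t F - F) by module, h2, smul_comm,
    inv_smul_smul₀ ht']

/-- The generator of the heat semigroup in `L¹(ℝ)` extends `F ↦ F'' / 2` on `W^{2,1}(ℝ)`. -/
theorem HasSecondDerivLine.tendsto_heat {F V : L1Line} {a b : ℝ}
    (hF : HasSecondDerivLine F V a b) :
    Tendsto (fun t : ℝ≥0 => (t : ℝ)⁻¹ • (heat t F - F)) (𝓝[>] 0) (𝓝 ((1 / 2 : ℝ) • V)) := by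
  have hc : Continuous fun t : ℝ≥0 =>
      ∫ z, z ^ 2 • triangleMean V (√t * |z|) ∂(gaussianReal 0 1) := by
    refine continuous_of_dominated (bound := fun z => z ^ 2 * (2 * ‖V‖)) (fun t => ?_) (fun t => ?_)
      (integrable_sq_gaussianReal.mul_const _) (Eventually.of_forall fun z => ?_)
    · have : Continuous fun z : ℝ => z ^ 2 • triangleMean V (√t * |z|) :=
        (continuous_pow 2).smul ((continuous_triangleMean V).comp (by fun_prop))
      exact this.aestronglyMeasurable
    · refine Eventually.of_forall fun z => ?_
      rw [norm_smul, Real.norm_of_nonneg (sq_nonneg z)]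
      exact mul_le_mul_of_nonneg_left (norm_triangleMean_le V _) (sq_nonneg z)
    · have : Continuous fun t : ℝ≥0 => triangleMean V (√t * |z|) :=
        (continuous_triangleMean V).comp (by fun_prop)
      exact this.const_smul (z ^ 2)
  have h0 : ∫ z, z ^ 2 • triangleMean V (√((0 : ℝ≥0) : ℝ) * |z|) ∂(gaussianReal 0 1) = V := by
    simp only [NNReal.coe_zero, Real.sqrt_zero, zero_mul, triangleMean_zero]
    rw [integral_smul_const, integral_sq_gaussianReal, one_smul]
  have h := (hc.tendsto 0).const_smul (1 / 2 : ℝ)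
  rw [h0] at h
  refine (h.mono_left nhdsWithin_le_nhds).congr' ?_
  filter_upwards [self_mem_nhdsWithin] with t ht
  exact (hF.heat_sub (ne_of_gt ht)).symm

/-- The boundary conditions in the domain of `A_α` say that the extensions of `ψ` to the line have
no jump at `0`, and neither have their derivatives. -/
theorem hasSecondDerivLine_starExt {α : Fin k → ℝ} (hpos : ∀ j, 0 < α j) (hsum : ∑ j, α j = 1)
    {ψ φ : L1Star k} {a b : Fin k → ℝ} (h : ∀ j, HasSecondDeriv (ψ j) (φ j) (a j) (b j))
    (hb : ∑ j, b j = 0) (ha : ∀ i j, a i / α i = a j / α j) (j : Fin k) :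
    HasSecondDerivLine (starExt α j ψ) (starExt α j φ) (a j) (b j) := by
  have hα := (hpos j).ne'
  have ha' : ∀ i, a i = a j / α j * α i := fun i => by
    rw [← ha i j, div_mul_cancel₀ _ (hpos i).ne']
  have hsa : ∑ i, a i = a j / α j := by
    rw [Finset.sum_congr rfl fun i _ => ha' i, ← Finset.mul_sum, hsum, mul_one]
  have h1 := ((HasSecondDeriv.sum Finset.univ fun i _ => h i).smul (2 * α j)).add
    ((h j).smul (-1))
  rw [hsa, hb, show 2 * α j * (a j / α j) + -1 * a j = a j by field_simp; ring,
    show 2 * α j * 0 + -1 * b j = -b j by ring, neg_one_smul, neg_one_smul, ← sub_eq_add_neg,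
    ← sub_eq_add_neg] at h1
  rw [starExt_apply, starExt_apply]
  exact (h j).glue h1

theorem tendsto_l1Star {ι : Type*} {l : Filter ι} {f : ι → L1Star k} {ψ : L1Star k}
    (h : ∀ j, Tendsto (fun i => f i j) l (𝓝 (ψ j))) : Tendsto f l (𝓝 ψ) :=
  ((PiLp.continuousLinearEquiv 1 ℝ (fun _ : Fin k => L1Half)).symm.continuous.tendsto _).comp
    (tendsto_pi_nhds.2 h)

/-- `A_α` is a restriction of the generator of the semigroup. -/
theorem walshDualGraph_le {α : Fin k → ℝ} (hpos : ∀ j, 0 < α j) (hsum : ∑ j, α j = 1) :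
    walshDualGraph α ≤
      generatorGraph fun t => (walshDualSemigroup α t : L1Star k →ₗ[ℝ] L1Star k) := by
  rintro ⟨ψ, χ⟩ ⟨φ, a, b, h, hb, ha, rfl⟩
  refine tendsto_l1Star fun j => ?_
  have h1 := (res.continuous.tendsto _).comp
    (hasSecondDerivLine_starExt hpos hsum h hb ha j).tendsto_heat
  rw [_root_.map_smul, res_starExt] at h1
  refine h1.congr fun t => ?_
  simp only [Function.comp_apply]
  rw [_root_.map_smul, _root_.map_sub, res_starExt]
  rfl

/-! ### The resolvent -/

/-- The Green function of `1 - d²/dx²` on the line. -/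
noncomputable def green (s : ℝ) : ℝ := Real.exp (-|s|) / 2

theorem continuous_green : Continuous green := by
  unfold green
  fun_prop

theorem green_nonneg (s : ℝ) : 0 ≤ green s := by
  unfold green
  positivity

theorem abs_green_le (s : ℝ) : |green s| ≤ 1 / 2 := by
  rw [abs_of_nonneg (green_nonneg s), green]
  have : Real.exp (-|s|) ≤ 1 := Real.exp_le_one_iff.2 (by simp)
  linarith

theorem green_neg (s : ℝ) : green (-s) = green s := by
  rw [green, green, abs_neg]

theorem green_of_nonneg {s : ℝ} (hs : 0 ≤ s) : green s = Real.exp (-s) / 2 := by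
  rw [green, abs_of_nonneg hs]

theorem green_of_nonpos {s : ℝ} (hs : s ≤ 0) : green s = Real.exp s / 2 := by
  rw [green, abs_of_nonpos hs, neg_neg]

theorem integrable_green : Integrable green := by
  rw [← integrableOn_univ, ← Iic_union_Ioi (a := (0 : ℝ)), integrableOn_union]
  constructor
  · refine IntegrableOn.congr_fun ((integrableOn_exp_Iic 0).div_const 2) (fun s hs => ?_)
      measurableSet_Iic
    rw [green_of_nonpos hs]
  · refine IntegrableOn.congr_fun ((integrableOn_exp_neg_Ioi 0).div_const 2) (fun s hs => ?_)
      measurableSet_Ioi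
    rw [green_of_nonneg (le_of_lt hs)]

/-- The derivative at `x = 0` of `x ↦ green (y - x)`. -/
noncomputable def greenSlope (y : ℝ) : ℝ :=
  if y ≤ 0 then -(Real.exp y / 2) else Real.exp (-y) / 2

theorem measurable_greenSlope : Measurable greenSlope :=
  Measurable.ite measurableSet_Iic (by fun_prop) (by fun_prop)

theorem abs_greenSlope (y : ℝ) : |greenSlope y| = green y := by
  unfold greenSlope
  split_ifs with hy
  · rw [abs_neg, green_of_nonpos hy, abs_of_pos (by positivity)]
  · rw [green_of_nonneg (by linarith), abs_of_pos (by positivity)]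

theorem greenSlope_neg {y : ℝ} (hy : y ≠ 0) : greenSlope (-y) = -greenSlope y := by
  unfold greenSlope
  rcases hy.lt_or_gt with h | h
  · rw [if_neg (by linarith), if_pos h.le, neg_neg, neg_neg]
  · rw [if_pos (by linarith), if_neg (by linarith)]

theorem integral_sub_mul_exp_sub (x y p q : ℝ) :
    ∫ z in p..q, (x - z) * (Real.exp (z - y) / 2) =
      (x - q + 1) * (Real.exp (q - y) / 2) - (x - p + 1) * (Real.exp (p - y) / 2) := by
  refine intervalIntegral.integral_eq_sub_of_hasDerivAt
    (f := fun z => (x - z + 1) * (Real.exp (z - y) / 2)) (fun z _ => ?_)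
    (Continuous.intervalIntegrable (by fun_prop) _ _)
  have h := (((hasDerivAt_id z).const_sub x).add_const 1).mul
    ((((hasDerivAt_id z).sub_const y).exp).div_const 2)
  refine h.congr_deriv ?_
  simp only [id]
  ring

theorem integral_sub_mul_exp_sub' (x y p q : ℝ) :
    ∫ z in p..q, (x - z) * (Real.exp (y - z) / 2) =
      (x - p - 1) * (Real.exp (y - p) / 2) - (x - q - 1) * (Real.exp (y - q) / 2) := by
  have h := intervalIntegral.integral_eq_sub_of_hasDerivAt (a := p) (b := q)
    (f := fun z => -((x - z - 1) * (Real.exp (y - z) / 2)))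
    (f' := fun z => (x - z) * (Real.exp (y - z) / 2)) (fun z _ => ?_)
    (Continuous.intervalIntegrable (by fun_prop) _ _)
  · rw [h]
    ring
  have h := ((((hasDerivAt_id z).const_sub x).sub_const 1).mul
    ((((hasDerivAt_id z).const_sub y).exp).div_const 2)).neg
  refine h.congr_deriv ?_
  simp only [id]
  ring

/-- The equation `g'' = g - δ_y` for `g z = green (y - z)`, in integrated form. -/
theorem integral_sub_mul_green {x : ℝ} (hx : 0 ≤ x) (y : ℝ) :
    ∫ z in (0 : ℝ)..x, (x - z) * green (y - z) =
      green (y - x) - green y - x * greenSlope y + (Ioc 0 x).indicator (fun y => x - y) y := by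
  have hl : ∀ p q, p ≤ q → q ≤ y → ∫ z in p..q, (x - z) * green (y - z) =
      (x - q + 1) * (Real.exp (q - y) / 2) - (x - p + 1) * (Real.exp (p - y) / 2) := by
    intro p q hpq hqy
    rw [← integral_sub_mul_exp_sub]
    refine intervalIntegral.integral_congr fun z hz => ?_
    rw [uIcc_of_le hpq] at hz
    rw [green_of_nonneg (by linarith [hz.2]), neg_sub]
  have hr : ∀ p q, p ≤ q → y ≤ p → ∫ z in p..q, (x - z) * green (y - z) =
      (x - p - 1) * (Real.exp (y - p) / 2) - (x - q - 1) * (Real.exp (y - q) / 2) := by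
    intro p q hpq hyp
    rw [← integral_sub_mul_exp_sub']
    refine intervalIntegral.integral_congr fun z hz => ?_
    rw [uIcc_of_le hpq] at hz
    rw [green_of_nonpos (by linarith [hz.1])]
  rcases le_or_gt y 0 with hy | hy
  · rw [hr 0 x hx hy, indicator_of_notMem (fun h => by linarith [h.1]),
      green_of_nonpos (by linarith : y - x ≤ 0), green_of_nonpos hy, greenSlope, if_pos hy]
    simp only [sub_zero]
    ring
  rcases le_or_gt y x with hyx | hyx
  · have hi : ∀ p q : ℝ, IntervalIntegrable (fun z => (x - z) * green (y - z)) volume p q :=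
      fun p q => Continuous.intervalIntegrable
        ((by fun_prop : Continuous fun z : ℝ => x - z).mul
          (continuous_green.comp (by fun_prop))) _ _
    rw [← intervalIntegral.integral_add_adjacent_intervals (hi 0 y) (hi y x),
      hl 0 y hy.le le_rfl, hr y x hyx le_rfl, indicator_of_mem (show y ∈ Ioc 0 x from ⟨hy, hyx⟩),
      green_of_nonpos (by linarith : y - x ≤ 0), green_of_nonneg hy.le, greenSlope,
      if_neg (by linarith), sub_self, Real.exp_zero, zero_sub]
    ring
  · rw [hl 0 x hx hyx.le, indicator_of_notMem (fun h => by linarith [h.2]),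
      green_of_nonneg (by linarith : 0 ≤ y - x), green_of_nonneg hy.le, greenSlope,
      if_neg (by linarith), zero_sub, neg_sub]
    ring

/-- The solution `U` of `U - U'' = F` in `L¹(ℝ)`. -/
noncomputable def greenConv (F : L1Line) : L1Line := ∫ s, green s • translation s F

theorem coeFn_greenConv (F : L1Line) :
    greenConv F =ᵐ[volume] fun x => ∫ y, green (y - x) * F y := by
  filter_upwards [coeFn_integral_translation integrable_green F] with x hx
  rw [greenConv, hx, ← integral_sub_right_eq_self _ x]
  simp

theorem integrable_mul_coeFn (F : L1Line) {h : ℝ → ℝ} (hm : Measurable h)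
    {C : ℝ} (hC : ∀ x, |h x| ≤ C) : Integrable (fun y => h y * F y) volume :=
  (L1.integrable_coeFn F).bdd_mul hm.aestronglyMeasurable (Eventually.of_forall hC)

theorem hasSecondDeriv_greenConv (F : L1Line) :
    HasSecondDeriv (res (greenConv F)) (res (greenConv F - F))
      (∫ y, green y * F y) (∫ y, greenSlope y * F y) := by
  have hdiff : ∀ᵐ x ∂halfLine, res (greenConv F - F) x = (∫ y, green (y - x) * F y) - F x := by
    filter_upwards [coeFn_res (greenConv F - F), ae_restrict_of_ae (coeFn_greenConv F),
      ae_restrict_of_ae (Lp.coeFn_sub (greenConv F) F)] with x h1 h2 h3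
    rw [h1, h3, Pi.sub_apply, h2]
  filter_upwards [coeFn_res (greenConv F), ae_restrict_of_ae (coeFn_greenConv F),
    ae_restrict_mem measurableSet_Ici] with x h1 h2 hx
  have hx : 0 ≤ x := hx
  rw [h1, h2, integral_kernel_congr hdiff hx]
  have hprod : Integrable (fun p : ℝ × ℝ => green (p.2 - p.1) * ((x - p.1) * F p.2))
      ((volume.restrict (Ioc 0 x)).prod volume) := by
    have hc : Integrable (fun z : ℝ => x - z) (volume.restrict (Ioc 0 x)) :=
      ((by fun_prop : Continuous fun z : ℝ => x - z).intervalIntegrable 0 x).1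
    exact (hc.mul_prod (L1.integrable_coeFn F)).bdd_mul
      (continuous_green.comp (by fun_prop)).aestronglyMeasurable
      (Eventually.of_forall fun p => abs_green_le _)
  -- Fubini's theorem reduces the claim to the equation of the Green function
  have hswap : ∫ z in (0 : ℝ)..x, (x - z) * ∫ y, green (y - z) * F y =
      ∫ y, (∫ z in (0 : ℝ)..x, (x - z) * green (y - z)) * F y := by
    simp only [intervalIntegral.integral_of_le hx, ← integral_const_mul, ← integral_mul_const]
    refine Eq.trans ?_ ((integral_integral_swap
      (f := fun z y => green (y - z) * ((x - z) * F y)) hprod).trans ?_)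
    · congr 1
      ext z
      congr 1
      ext y
      ring
    · congr 1
      ext y
      congr 1
      ext z
      ring
  have hJ : ∫ y, (Ioc 0 x).indicator (fun y => x - y) y * F y =
      ∫ y in (0 : ℝ)..x, (x - y) * F y := by
    rw [intervalIntegral.integral_of_le hx, ← integral_indicator measurableSet_Ioc]
    congr 1
    ext y
    by_cases hy : y ∈ Ioc 0 x <;> simp [hy]
  have hi1 : IntervalIntegrable (fun z => (x - z) * ∫ y, green (y - z) * F y) volume 0 x := by
    have h := (intervalIntegrable_coeFn (greenConv F) 0 x).continuousOn_mul
      (by fun_prop : ContinuousOn (fun z : ℝ => x - z) (uIcc 0 x))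
    refine h.congr_ae (ae_restrict_of_ae ?_)
    filter_upwards [coeFn_greenConv F] with z hz
    rw [hz]
  have hi2 : IntervalIntegrable (fun z => (x - z) * F z) volume 0 x :=
    (intervalIntegrable_coeFn F 0 x).continuousOn_mul (by fun_prop)
  have hg : ∀ c : ℝ, Integrable (fun y => green (y - c) * F y) := fun c =>
    integrable_mul_coeFn F (continuous_green.measurable.comp (by fun_prop))
      fun y => abs_green_le _
  have hg0 : Integrable (fun y => green y * F y) := by simpa using hg 0
  have hs : Integrable (fun y => greenSlope y * F y) :=
    integrable_mul_coeFn F measurable_greenSlope fun y => (abs_greenSlope y).trans_le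
      ((le_abs_self _).trans (abs_green_le y))
  have hk : Integrable (fun y => (Ioc 0 x).indicator (fun y => x - y) y * F y) := by
    refine integrable_mul_coeFn F (C := x) ((by fun_prop : Measurable fun y : ℝ => x - y).indicator
      measurableSet_Ioc) fun y => ?_
    by_cases hy : y ∈ Ioc 0 x
    · rw [indicator_of_mem hy, abs_le]
      constructor <;> linarith [hy.1, hy.2]
    · rw [indicator_of_notMem hy, abs_zero]
      exact hx
  have h3 : ∫ z in (0 : ℝ)..x, (x - z) * ((∫ y, green (y - z) * F y) - F z) =
      (∫ y, (∫ z in (0 : ℝ)..x, (x - z) * green (y - z)) * F y) -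
        ∫ z in (0 : ℝ)..x, (x - z) * F z := by
    rw [← hswap, ← intervalIntegral.integral_sub hi1 hi2]
    congr 1
    ext z
    ring
  have h4 : ∫ y, (∫ z in (0 : ℝ)..x, (x - z) * green (y - z)) * F y =
      (∫ y, green (y - x) * F y) - (∫ y, green y * F y) - x * (∫ y, greenSlope y * F y) +
        ∫ y in (0 : ℝ)..x, (x - y) * F y := by
    have hd : Integrable fun y => green (y - x) * F y - green y * F y := (hg x).sub hg0
    have hd' : Integrable fun y =>
        green (y - x) * F y - green y * F y - x * (greenSlope y * F y) := hd.sub (hs.const_mul x)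
    rw [← hJ, ← integral_const_mul, ← integral_sub (hg x) hg0,
      ← integral_sub hd (hs.const_mul x), ← integral_add hd' hk]
    congr 1
    ext y
    rw [integral_sub_mul_green hx]
    ring
  rw [h3, h4]
  ring

theorem integral_mul_reflection (h : ℝ → ℝ) (F : L1Line) :
    ∫ y, h y * reflection F y = ∫ y, h (-y) * F y := by
  rw [← integral_neg_eq_self]
  refine integral_congr_ae ?_
  filter_upwards [ae_neg (coeFn_reflection F)] with y hy
  rw [hy, neg_neg]

/-- `1/2 - A_α` is surjective. -/
theorem exists_mem_walshDualGraph {α : Fin k → ℝ} (hpos : ∀ j, 0 < α j) (hsum : ∑ j, α j = 1)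
    (χ : L1Star k) : ∃ p ∈ walshDualGraph α, (1 / 2 : ℝ) • p.1 - p.2 = χ := by
  -- `ψ / 2 - ψ'' / 2 = χ` is `ψ - ψ'' = 2 χ`
  set F : Fin k → L1Line := fun j => starExt α j ((2 : ℝ) • χ) with hF
  let A := pairing volume green continuous_green.measurable (1 / 2) abs_green_le
  let B := pairing volume greenSlope measurable_greenSlope (1 / 2) fun y =>
    (abs_greenSlope y).trans_le ((le_abs_self _).trans (abs_green_le y))
  have hA' : ∀ f, A f = ∫ y, green y * f y := pairing_apply volume _ _ _ _
  have hB' : ∀ f, B f = ∫ y, greenSlope y * f y := pairing_apply volume _ _ _ _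
  clear_value A B
  have hA : ∀ f, A (reflection f) = A f := fun f => by
    rw [hA', hA', integral_mul_reflection]
    simp only [green_neg]
  have hB : ∀ f, B (reflection f) = -B f := fun f => by
    rw [hB', hB', integral_mul_reflection, ← integral_neg]
    refine integral_congr_ae ?_
    filter_upwards [Measure.ae_ne volume (0 : ℝ)] with y hy
    rw [greenSlope_neg hy, neg_mul]
  refine ⟨(WithLp.toLp 1 fun j => res (greenConv (F j)),
    (1 / 2 : ℝ) • WithLp.toLp 1 fun j => res (greenConv (F j) - F j)),
    ⟨WithLp.toLp 1 fun j => res (greenConv (F j) - F j), fun j => A (F j), fun j => B (F j),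
      fun j => ?_, ?_, ?_, rfl⟩, ?_⟩
  · change HasSecondDeriv (res (greenConv (F j))) (res (greenConv (F j) - F j)) (A (F j)) (B (F j))
    rw [hA', hB']
    exact hasSecondDeriv_greenConv (F j)
  · -- the sum of the extensions is even, and `greenSlope` is odd
    have h : reflection (∑ i, F i) = ∑ i, F i := by
      simp only [hF]
      rw [sum_starExt hsum, glue, _root_.map_add, reflection_reflection, add_comm]
    have h1 := hB (∑ i, F i)
    rw [h] at h1
    rw [← _root_.map_sum]
    linarith
  · -- `green` is even, so the relation between the extensions passes to the values at `0`
    have h : ∀ j, A (F j) / α j = A (∑ i, F i) := fun j => by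
      have h1 := congrArg A (starExt_add_reflection hsum ((2 : ℝ) • χ) j)
      rw [_root_.map_add, hA, _root_.map_smul A (2 * α j), smul_eq_mul] at h1
      rw [div_eq_iff (hpos j).ne']
      change A (F j) + A (F j) = 2 * α j * A (∑ i, F i) at h1
      linarith
    intro i j
    rw [h, h]
  · ext1 j
    change (1 / 2 : ℝ) • res (greenConv (F j)) - (1 / 2 : ℝ) • res (greenConv (F j) - F j) = χ j
    rw [_root_.map_sub, hF, res_starExt]
    change _ - (1 / 2 : ℝ) • (_ - (2 : ℝ) • χ j) = χ j
    module

/-- `1/2 - G` is injective for the generator `G` of the semigroup, because the extension to the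
line intertwines the semigroup with a contraction semigroup. -/
theorem eq_zero_of_mem_generatorGraph {α : Fin k → ℝ} (hsum : ∑ j, α j = 1) {ψ : L1Star k}
    (h : (ψ, (1 / 2 : ℝ) • ψ) ∈
      generatorGraph fun t => (walshDualSemigroup α t : L1Star k →ₗ[ℝ] L1Star k)) : ψ = 0 := by
  have h : Tendsto (fun t : ℝ≥0 => (t : ℝ)⁻¹ • (walshDualSemigroup α t ψ - ψ)) (𝓝[>] 0)
    (𝓝 ((1 / 2 : ℝ) • ψ)) := h
  ext1 j
  set F := starExt α j ψ with hF
  have h1 : Tendsto (fun t : ℝ≥0 => (t : ℝ)⁻¹ • (heat t F - F)) (𝓝[>] 0)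
      (𝓝 ((1 / 2 : ℝ) • F)) := by
    have h2 := ((starExt α j).continuous.tendsto _).comp h
    rw [_root_.map_smul] at h2
    refine h2.congr fun t => ?_
    rw [Function.comp_apply, _root_.map_smul, _root_.map_sub, starExt_walshDualSemigroup hsum]
  -- dissipativity of the difference quotients of a contraction semigroup
  have h3 : ∀ᶠ t : ℝ≥0 in 𝓝[>] 0,
      1 / 2 * ‖F‖ ≤ ‖(1 / 2 : ℝ) • F - (t : ℝ)⁻¹ • (heat t F - F)‖ := by
    filter_upwards [self_mem_nhdsWithin] with t ht
    have ht : (0 : ℝ) < (t : ℝ)⁻¹ := inv_pos.2 (NNReal.coe_pos.2 ht)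
    have h4 := norm_sub_norm_le ((1 / 2 + (t : ℝ)⁻¹) • F) ((t : ℝ)⁻¹ • heat t F)
    rw [norm_smul, norm_smul, Real.norm_of_nonneg ht.le,
      Real.norm_of_nonneg (by positivity)] at h4
    have h5 := mul_le_mul_of_nonneg_left (norm_heat_le t F) ht.le
    rw [show (1 / 2 : ℝ) • F - (t : ℝ)⁻¹ • (heat t F - F) =
      (1 / 2 + (t : ℝ)⁻¹) • F - (t : ℝ)⁻¹ • heat t F by module]
    linarith
  have h4 := ge_of_tendsto (h1.const_sub ((1 / 2 : ℝ) • F)).norm h3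
  rw [sub_self, norm_zero] at h4
  have h5 : F = 0 := norm_eq_zero.1 (le_antisymm (by linarith) (norm_nonneg _))
  have h6 := res_starExt α j ψ
  rw [← hF, h5, _root_.map_zero] at h6
  rw [← h6]
  rfl

/-- An extension of `A_α` for which `1/2 - G` is injective cannot be proper, as `1/2 - A_α` is
surjective. -/
theorem generator_walshDualSemigroup {α : Fin k → ℝ} (hpos : ∀ j, 0 < α j)
    (hsum : ∑ j, α j = 1) :
    generator (fun t => (walshDualSemigroup α t : L1Star k →ₗ[ℝ] L1Star k)) =
      walshDualOperator α := by
  refine LinearPMap.eq_of_eq_graph ?_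
  rw [generator_graph, walshDualOperator_graph]
  refine le_antisymm ?_ (walshDualGraph_le hpos hsum)
  rintro p hp
  obtain ⟨q, hq, hpq⟩ := exists_mem_walshDualGraph hpos hsum ((1 / 2 : ℝ) • p.1 - p.2)
  have h := sub_mem hp (walshDualGraph_le hpos hsum hq)
  have h1 : p - q = (p.1 - q.1, (1 / 2 : ℝ) • (p.1 - q.1)) := by
    refine Prod.ext rfl ?_
    change p.2 - q.2 = (1 / 2 : ℝ) • (p.1 - q.1)
    have h2 : p.2 = (1 / 2 : ℝ) • p.1 - ((1 / 2 : ℝ) • q.1 - q.2) := by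
      rw [hpq, sub_sub_cancel]
    rw [h2]
    module
  rw [h1] at h
  have h2 := eq_zero_of_mem_generatorGraph hsum h
  rw [h2, smul_zero] at h1
  rwa [sub_eq_zero.1 h1]

/-! ### Duality between the two semigroups -/

theorem measurable_c0 (g : C0Half) : Measurable fun x : ℝ => g x.toNNReal :=
  ((map_continuous g).comp continuous_pos).measurable

theorem abs_c0_le (g : C0Half) (x : ℝ≥0) : |g x| ≤ ‖g‖ := g.toBCF.norm_coe_le_norm x

/-- The pairing of `C₀[0, ∞)` and `L¹(ℝ⁺)`. -/
noncomputable def c0Pairing : C0Half →L[ℝ] L1Half →L[ℝ] ℝ :=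
  LinearMap.mkContinuous
    { toFun := fun g => pairing halfLine (fun x => g x.toNNReal) (measurable_c0 g) ‖g‖
        fun _ => abs_c0_le g _
      map_add' := fun g h => by
        ext u
        rw [_root_.add_apply, pairing_apply, pairing_apply, pairing_apply,
          ← integral_add ((L1.integrable_coeFn u).bdd_mul (measurable_c0 g).aestronglyMeasurable
            (Eventually.of_forall fun _ => abs_c0_le g _))
          ((L1.integrable_coeFn u).bdd_mul (measurable_c0 h).aestronglyMeasurable
            (Eventually.of_forall fun _ => abs_c0_le h _))]
        simp only [ZeroAtInftyContinuousMap.add_apply, add_mul]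
      map_smul' := fun c g => by
        ext u
        rw [RingHom.id_apply, _root_.smul_apply, pairing_apply, pairing_apply,
          smul_eq_mul, ← integral_const_mul]
        simp only [ZeroAtInftyContinuousMap.smul_apply, smul_eq_mul, mul_assoc] } 1 fun g => by
    rw [one_mul]
    exact norm_pairing_le _ _ (measurable_c0 g) (fun _ => abs_c0_le g _) (norm_nonneg g)

theorem c0Pairing_apply (g : C0Half) (u : L1Half) :
    c0Pairing g u = ∫ x in Ici (0 : ℝ), g x.toNNReal * u x := rfl

theorem starMean_eq (α : Fin k → ℝ) (f : C0Star k) : starMean α f = ∑ i, α i • f.1 i := by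
  simp [starMean]

/-- The extension of the edge `j` of `f ∈ C₀(S_k)` to the line, by `2 f̄ - f j` on the left. It is
written as the odd extension of `f j - f̄` plus the even extension of `f̄`, on which the minimal and
the reflecting semigroup act. -/
noncomputable def edgeExt (α : Fin k → ℝ) (f : C0Star k) (j : Fin k) (z : ℝ) : ℝ :=
  ((f.1 j - starMean α f) z.toNNReal - (f.1 j - starMean α f) (-z).toNNReal) +
    starMean α f (Real.nnabs z)

theorem measurable_edgeExt (α : Fin k → ℝ) (f : C0Star k) (j : Fin k) :
    Measurable (edgeExt α f j) :=
  ((measurable_c0 _).sub ((measurable_c0 _).comp measurable_neg)).add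
    ((map_continuous (starMean α f)).comp continuous_nnabs).measurable

theorem abs_edgeExt_le (α : Fin k → ℝ) (f : C0Star k) (j : Fin k) (z : ℝ) :
    |edgeExt α f j z| ≤ 2 * ‖f.1 j - starMean α f‖ + ‖starMean α f‖ := by
  have h1 := abs_c0_le (f.1 j - starMean α f) z.toNNReal
  have h2 := abs_c0_le (f.1 j - starMean α f) (-z).toNNReal
  have h3 := abs_c0_le (starMean α f) (Real.nnabs z)
  rw [abs_le] at *
  unfold edgeExt
  constructor <;> linarith [h1.1, h1.2, h2.1, h2.2, h3.1, h3.2]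

theorem edgeExt_of_nonneg {α : Fin k → ℝ} (hsum : ∑ j, α j = 1) (f : C0Star k) (j : Fin k)
    {x : ℝ} (hx : 0 ≤ x) : edgeExt α f j x = f.1 j x.toNNReal := by
  have h0 : (f.1 j - starMean α f) 0 = 0 := sub_starMean_mem hsum f j
  have hn : Real.nnabs x = x.toNNReal := Real.nnabs_of_nonneg hx
  rw [edgeExt, Real.toNNReal_of_nonpos (by linarith : -x ≤ 0), h0, hn,
    ZeroAtInftyContinuousMap.sub_apply]
  ring

theorem edgeExt_neg {α : Fin k → ℝ} (hsum : ∑ j, α j = 1) (f : C0Star k) (j : Fin k)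
    {x : ℝ} (hx : 0 ≤ x) :
    edgeExt α f j (-x) = ((2 : ℝ) • starMean α f - f.1 j) x.toNNReal := by
  have h0 : (f.1 j - starMean α f) 0 = 0 := sub_starMean_mem hsum f j
  have hn : Real.nnabs (-x) = x.toNNReal := by
    ext
    simp [abs_of_nonneg hx, max_eq_left hx]
  rw [edgeExt, Real.toNNReal_of_nonpos (by linarith : -x ≤ 0), h0, hn, neg_neg,
    ZeroAtInftyContinuousMap.sub_apply, ZeroAtInftyContinuousMap.sub_apply,
    ZeroAtInftyContinuousMap.smul_apply, smul_eq_mul]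
  ring

/-- Walsh's semigroup extends an edge to the line and applies the heat semigroup, just as the
semigroup in `L¹(S_k)` does. -/
theorem walshSemigroup_apply {α : Fin k → ℝ} (hsum : ∑ j, α j = 1) (t : ℝ≥0) (f : C0Star k)
    (j : Fin k) (x : ℝ≥0) :
    (walshSemigroup α hsum t f).1 j x = ∫ w, edgeExt α f j (x + w) ∂(gaussianReal 0 t) := by
  have h := integral_add
    ((integrable_pos (f.1 j - starMean α f) t x).sub
      (integrable_neg_part (f.1 j - starMean α f) t x))
    (integrable_comp (starMean α f) (gaussianReal 0 t)
      (continuous_nnabs.comp (by fun_prop : Continuous fun w : ℝ => (x : ℝ) + w)))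
  exact h.symm

/-- The integral over the line, as the sum of the integrals over its two halves. -/
theorem integral_mul_eq_add_res {h : ℝ → ℝ} (hm : Measurable h) {C : ℝ} (hC : ∀ x, |h x| ≤ C)
    (F : L1Line) :
    ∫ x, h x * F x = (∫ x in Ici (0 : ℝ), h x * res F x) +
      ∫ x in Ici (0 : ℝ), h (-x) * res (reflection F) x := by
  have hi := integrable_mul_coeFn F hm hC
  have h1 : ∫ x in Ici (0 : ℝ), h x * res F x = ∫ x in Ici (0 : ℝ), h x * F x := by
    refine integral_congr_ae ?_
    filter_upwards [coeFn_res F] with x hx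
    rw [hx]
  have h2 : ∫ x in Ici (0 : ℝ), h (-x) * res (reflection F) x = ∫ x in Iic (0 : ℝ), h x * F x := by
    have h3 := integral_comp_neg_Ioi (0 : ℝ) fun x => h x * F x
    rw [neg_zero] at h3
    rw [← h3, ← integral_Ici_eq_integral_Ioi]
    refine integral_congr_ae ?_
    filter_upwards [coeFn_res (reflection F), ae_restrict_of_ae (coeFn_reflection F)] with x h1 h2
    rw [h1, h2]
  rw [h1, h2, integral_Ici_eq_integral_Ioi, add_comm,
    intervalIntegral.integral_Iic_add_Ioi hi.integrableOn hi.integrableOn]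

theorem c0Pairing_walshSemigroup {α : Fin k → ℝ} (hsum : ∑ j, α j = 1) (t : ℝ≥0) (f : C0Star k)
    (j : Fin k) (u : L1Half) :
    c0Pairing ((walshSemigroup α hsum t f).1 j) u =
      c0Pairing (f.1 j) (res (heat t (zeroExt u))) +
        c0Pairing ((2 : ℝ) • starMean α f - f.1 j) (res (heat t (reflection (zeroExt u)))) := by
  have h1 : c0Pairing ((walshSemigroup α hsum t f).1 j) u =
      ∫ x, (∫ w, edgeExt α f j (x + w) ∂(gaussianReal 0 t)) * zeroExt u x := by
    rw [c0Pairing_apply, ← integral_indicator measurableSet_Ici]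
    refine integral_congr_ae ?_
    filter_upwards [coeFn_zeroExt u] with x hx
    rw [hx]
    by_cases hx0 : x ∈ Ici (0 : ℝ)
    · rw [indicator_of_mem hx0, indicator_of_mem hx0, walshSemigroup_apply,
        Real.coe_toNNReal x hx0]
    · rw [indicator_of_notMem hx0, indicator_of_notMem hx0, mul_zero]
  rw [h1, ← integral_mul_heat t _ (measurable_edgeExt α f j) (abs_edgeExt_le α f j),
    integral_mul_eq_add_res (measurable_edgeExt α f j) (abs_edgeExt_le α f j),
    c0Pairing_apply, c0Pairing_apply, reflection_heat]
  congr 1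
  · refine setIntegral_congr_fun measurableSet_Ici fun x hx => ?_
    simp only [edgeExt_of_nonneg hsum f j hx]
  · refine setIntegral_congr_fun measurableSet_Ici fun x hx => ?_
    simp only [edgeExt_neg hsum f j hx]

/-- The semigroup in `L¹(S_k)` is the predual of Walsh's semigroup. -/
theorem sum_c0Pairing_walshSemigroup {α : Fin k → ℝ} (hsum : ∑ j, α j = 1) (t : ℝ≥0)
    (f : C0Star k) (ψ : L1Star k) :
    ∑ j, c0Pairing ((walshSemigroup α hsum t f).1 j) (ψ j) =
      ∑ j, c0Pairing (f.1 j) (walshDualSemigroup α t ψ j) := by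
  set Q : Fin k → L1Half := fun j => res (heat t (reflection (zeroExt (ψ j)))) with hQ
  have h1 : ∀ j, walshDualSemigroup α t ψ j =
      res (heat t (zeroExt (ψ j))) + ((2 * α j) • (∑ i, Q i) - Q j) := fun j => by
    rw [walshDualSemigroup_apply, starExt_apply, glue, hQ]
    simp only [_root_.map_add, _root_.map_sub, _root_.map_smul, _root_.map_sum]
  have h2 : ∑ j, c0Pairing ((2 : ℝ) • starMean α f) (Q j) =
      ∑ j, c0Pairing (f.1 j) ((2 * α j) • ∑ i, Q i) := by
    simp only [starMean_eq, _root_.map_smul, _root_.map_sum, _root_.smul_apply,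
      _root_.sum_apply, smul_eq_mul, Finset.mul_sum, mul_assoc]
    exact Finset.sum_comm
  simp only [c0Pairing_walshSemigroup, h1, _root_.map_add, _root_.map_sub,
    _root_.sub_apply, Finset.sum_add_distrib, Finset.sum_sub_distrib]
  rw [← h2]

/-- The duality of the semigroups, differentiated at `t = 0`. -/
theorem sum_c0Pairing_generator {α : Fin k → ℝ} (hsum : ∑ j, α j = 1) {f g : C0Star k}
    {ψ χ : L1Star k} (hf : (f, g) ∈ generatorGraph (E := C0Star k) (walshSemigroup α hsum))
    (hψ : (ψ, χ) ∈
      generatorGraph fun t => (walshDualSemigroup α t : L1Star k →ₗ[ℝ] L1Star k)) :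
    ∑ j, c0Pairing (f.1 j) (χ j) = ∑ j, c0Pairing (g.1 j) (ψ j) := by
  have hf : Tendsto (fun t : ℝ≥0 => (t : ℝ)⁻¹ • (walshSemigroup α hsum t f - f)) (𝓝[>] 0)
    (𝓝 g) := hf
  have hψ : Tendsto (fun t : ℝ≥0 => (t : ℝ)⁻¹ • (walshDualSemigroup α t ψ - ψ)) (𝓝[>] 0)
    (𝓝 χ) := hψ
  have hc1 : Continuous fun φ : L1Star k => ∑ j, c0Pairing (f.1 j) (φ j) :=
    continuous_finsetSum _ fun j _ =>
      (c0Pairing (f.1 j)).continuous.comp (PiLp.proj 1 (𝕜 := ℝ) (fun _ => L1Half) j).continuous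
  have hc2 : Continuous fun h : C0Star k => ∑ j, c0Pairing (h.1 j) (ψ j) :=
    continuous_finsetSum _ fun j _ => ((ContinuousLinearMap.apply ℝ ℝ (ψ j)).continuous.comp
      c0Pairing.continuous).comp ((continuous_apply j).comp continuous_subtype_val)
  refine tendsto_nhds_unique ((hc1.tendsto χ).comp hψ) (((hc2.tendsto g).comp hf).congr fun t => ?_)
  have h := sum_c0Pairing_walshSemigroup hsum t f ψ
  change ∑ j, c0Pairing ((t : ℝ)⁻¹ • ((walshSemigroup α hsum t f).1 j - f.1 j)) (ψ j) =
    ∑ j, c0Pairing (f.1 j) ((t : ℝ)⁻¹ • (walshDualSemigroup α t ψ j - ψ j))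
  simp only [_root_.map_smul, _root_.map_sub, _root_.smul_apply,
    _root_.sub_apply, ← Finset.smul_sum, Finset.sum_sub_distrib, h]

end WalshSpider

open WalshSpider in
theorem mainTheorem3 {k : ℕ} (α : Fin k → ℝ) (hpos : ∀ j, 0 < α j) (hsum : ∑ j, α j = 1) :
    (∃ T : ℝ≥0 → L1Star k →L[ℝ] L1Star k,
      IsMarkovSemigroup T ∧
      generator (fun t => (T t : L1Star k →ₗ[ℝ] L1Star k)) = walshDualOperator α) ∧
    ∀ (f : (walshGenerator α hsum).domain) (ψ : (walshDualOperator α).domain),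
      starIntegral (fun j x => (f : C0Star k).1 j x.toNNReal * walshDualOperator α ψ j x) =
        starIntegral (fun j x =>
          (walshGenerator α hsum f).1 j x.toNNReal * (ψ : L1Star k) j x) := by
  refine ⟨⟨walshDualSemigroup α, isMarkovSemigroup_walshDualSemigroup hpos hsum,
    generator_walshDualSemigroup hpos hsum⟩, fun f ψ => ?_⟩
  have hf : ((f : C0Star k), walshGenerator α hsum f) ∈
      (generator (E := C0Star k) (walshSemigroup α hsum)).graph :=
    (walshGenerator α hsum).mem_graph f
  have hψ := (walshDualOperator α).mem_graph ψ
  rw [generator_graph] at hf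
  rw [walshDualOperator_graph] at hψ
  exact sum_c0Pairing_generator hsum hf (walshDualGraph_le hpos hsum hψ)
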